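/- **Convex distance to the modified normal approximation.** Let $(\mathbf X_n)_{n\in\mathbb N}$ be random vectors in $\mathbb R^d$, $K$ a symmetric positive-definite real $d\times d$ matrix, and $(t_n)$ real numbers with $t_n\to+\infty$. Put $\theta_n(\zeta)=\mathbb E[e^{i\langle\zeta,\mathbf X_n\rangle}]\,e^{t_n\zeta^tK\zeta/2}$ for $\zeta\in\mathbb R^d$. Hypothesis (BE2): the functions $\theta_n$ and a function $\theta:\mathbb R^d\to\mathbb C$ are of class $C^{d+1}$, and $\theta_n$ and all its partial derivatives up to order $d+1$ converge, locally uniformly on $\mathbb R^d$, to $\theta$ and its corresponding partial derivatives. Let $\mu_n$ be the law of $\mathbf X_n/\sqrt{t_n}$ (a finite number of indices with $t_n\le 0$ is immaterial), and let $\nu_n$ be the signed measure on $\mathbb R^d$ with density $$\frac{1}{\sqrt{(2\pi)^d\det K}}\,e^{-\frac{x^tK^{-1}x}{2}}\Bigl(1-i\,\frac{x^tK^{-1}\nabla\theta(0)}{\sqrt{t_n}}\Bigr)$$ (the vector $\nabla\theta(0)$ is purely imaginary). For a probability measure $\mu$ and a signed measure $\nu$, let $d_{\mathrm{convex}}(\mu,\nu)=\sup_C|\mu(C)-\nu(C)|$,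 the supremum being over the convex Borel sets $C\subset\mathbb R^d$. 1. If (BE2) holds, then $\nu_n$ has the Fourier transform $$\int_{\mathbb R^d} e^{i\langle\zeta,x\rangle}\,\nu_n(dx)=e^{-\frac{\zeta^tK\zeta}{2}}\Bigl(1+\frac{\zeta^t\nabla\theta(0)}{\sqrt{t_n}}\Bigr),$$ and $d_{\mathrm{convex}}(\mu_n,\nu_n)=o(1/\sqrt{t_n})$ as $n\to\infty$. 2. The rate depends only on $d$, on a bound for the spectral radius $\rho(K^{-1})$, on the rate at which $\nabla(\theta_n-\theta)(0)$ tends to $0$, on the rate at which $t_n\to\infty$, and on local bounds for the residues $\theta_n$ and their partial derivatives up to order $d+1$. Precisely: given $d$, $R\in\mathbb R$, real sequences $T_n\to+\infty$ and $r_n\to0$, and a function $M$ on $(0,\infty)$, for every $\eta>0$ there is an $N$ such that $\sqrt{t_n}\,d_{\mathrm{convex}}(\mu_n,\nu_n)\le\eta$ for all $n\ge N$ and for all data $((\mathbf X_n),K,(t_n),\theta)$ as above that satisfy (BE2), $\rho(K^{-1})\le R$ and, for all $n$, $t_n\ge T_n$, $\|\nabla(\theta_n-\theta)(0)\|_\infty\le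 r_n$, and $|\partial^\alpha\theta_n(\zeta)|\le M(B)$ for all $B>0$, $|\alpha|\le d+1$ and $\zeta\in[-B,B]^d$. -/

import Mathlib

open MeasureTheory Filter Topology Asymptotics
open scoped Matrix RealInnerProductSpace

noncomputable section

/-- The quadratic form `xᵗ K x`. -/
def quadForm {d : ℕ} (K : Matrix (Fin d) (Fin d) ℝ) (x : EuclideanSpace ℝ (Fin d)) : ℝ :=
  WithLp.ofLp x ⬝ᵥ (K *ᵥ WithLp.ofLp x)

/-- The residue `θ(ζ) = 𝔼[exp (i ⟨ζ, X⟩)] exp (t ζᵗ K ζ / 2)` of a random vector `X` with law `μ`. -/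
def residue {d : ℕ} (μ : Measure (EuclideanSpace ℝ (Fin d))) (K : Matrix (Fin d) (Fin d) ℝ)
    (t : ℝ) (ζ : EuclideanSpace ℝ (Fin d)) : ℂ :=
  charFun μ ζ * Complex.exp ((t * quadForm K ζ / 2 : ℝ) : ℂ)

/-- The iterated partial derivative of order `k` of `f`, in the coordinates `α 0, …, α (k - 1)`
(used for functions of class `C^k`, where the order of the coordinates is irrelevant, so that
these are the derivatives by multi-indices of weight `k`). -/
def partialDeriv {d k : ℕ} (α : Fin k → Fin d) (f : EuclideanSpace ℝ (Fin d) → ℂ)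
    (ζ : EuclideanSpace ℝ (Fin d)) : ℂ :=
  iteratedFDeriv ℝ k f ζ (fun j => EuclideanSpace.single (α j) (1 : ℝ))

/-- The gradient `(∂f/∂ζ₁, …, ∂f/∂ζ_d)` at the origin of a complex-valued function. -/
def gradAtZero {d : ℕ} (f : EuclideanSpace ℝ (Fin d) → ℂ) : Fin d → ℂ :=
  fun i => fderiv ℝ f 0 (EuclideanSpace.single i (1 : ℝ))

/-- Mod-Gaussian convergence in the strong Fourier sense, for the sequence of laws `μ n` of random
vectors, with parameters `t n • K` and limit `θ`: the residues and all their partial derivatives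
up to order `d + 1` converge locally uniformly on `ℝ^d` to `θ` and its partial derivatives. -/
structure StrongFourierModGaussian {d : ℕ} (μ : ℕ → Measure (EuclideanSpace ℝ (Fin d)))
    (K : Matrix (Fin d) (Fin d) ℝ) (t : ℕ → ℝ) (θ : EuclideanSpace ℝ (Fin d) → ℂ) : Prop where
  posDef : K.PosDef
  tendsto_param : Tendsto t atTop atTop
  contDiff_residue : ∀ n, ContDiff ℝ ((d + 1 : ℕ) : WithTop ℕ∞) (residue (μ n) K (t n))
  contDiff_limit : ContDiff ℝ ((d + 1 : ℕ) : WithTop ℕ∞) θ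
  tendsto_partialDeriv : ∀ k ≤ d + 1, ∀ α : Fin k → Fin d,
    TendstoLocallyUniformly (fun n => partialDeriv α (residue (μ n) K (t n)))
      (partialDeriv α θ) atTop

/-- The law of the rescaled vector `X / √t`. -/
def rescaledLaw {d : ℕ} {Ω : Type*} [MeasurableSpace Ω] (P : Measure Ω)
    (X : Ω → EuclideanSpace ℝ (Fin d)) (t : ℝ) : Measure (EuclideanSpace ℝ (Fin d)) :=
  P.map (fun ω => (Real.sqrt t)⁻¹ • X ω)

/-- The density
`((2π)^d det K)^(-1/2) exp (- xᵗ K⁻¹ x / 2) (1 - i xᵗ K⁻¹ g / √t)`.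
The vector `g` is meant to be purely imaginary, so that the last factor is real. -/
def modifiedGaussianDensity {d : ℕ} (K : Matrix (Fin d) (Fin d) ℝ) (g : Fin d → ℂ) (t : ℝ)
    (x : EuclideanSpace ℝ (Fin d)) : ℝ :=
  (Real.sqrt ((2 * Real.pi) ^ d * K.det))⁻¹ * Real.exp (-(quadForm K⁻¹ x) / 2) *
    (1 - Complex.I * ((fun i => (x i : ℂ)) ⬝ᵥ ((K⁻¹).map (fun r : ℝ => (r : ℂ)) *ᵥ g)) /
      (Real.sqrt t : ℂ)).re

/-- The modified Gaussian distribution, a signed measure. -/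
def modifiedGaussian {d : ℕ} (K : Matrix (Fin d) (Fin d) ℝ) (g : Fin d → ℂ) (t : ℝ) :
    SignedMeasure (EuclideanSpace ℝ (Fin d)) :=
  (volume : Measure (EuclideanSpace ℝ (Fin d))).withDensityᵥ (modifiedGaussianDensity K g t)

/-- The Fourier transform `∫ exp (i ⟨ζ, x⟩) ν(dx)` of a signed measure. -/
def signedFourier {d : ℕ} (ν : SignedMeasure (EuclideanSpace ℝ (Fin d)))
    (ζ : EuclideanSpace ℝ (Fin d)) : ℂ :=
  ∫ᵛ x, Complex.exp (((⟪ζ, x⟫ : ℝ) : ℂ) * Complex.I) ∂<•ν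

/-- The convex distance: the supremum of `|μ(C) - ν(C)|` over convex Borel sets `C`. -/
def convexDist {d : ℕ} (μ : Measure (EuclideanSpace ℝ (Fin d)))
    (ν : SignedMeasure (EuclideanSpace ℝ (Fin d))) : ℝ :=
  ⨆ C : {C : Set (EuclideanSpace ℝ (Fin d)) // MeasurableSet C ∧ Convex ℝ C},
    |μ.real C.1 - ν C.1|

/-- The supremum in the convex distance is one of a bounded set. -/
theorem convexDist_bddAbove {d : ℕ} (μ : Measure (EuclideanSpace ℝ (Fin d))) [IsFiniteMeasure μ]
    (ν : SignedMeasure (EuclideanSpace ℝ (Fin d))) :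
    BddAbove (Set.range fun C : {C : Set (EuclideanSpace ℝ (Fin d)) //
      MeasurableSet C ∧ Convex ℝ C} => |μ.real C.1 - ν C.1|) := by
  refine ⟨μ.real Set.univ + ν.totalVariation.real Set.univ, ?_⟩
  rintro _ ⟨C, rfl⟩
  have h1 : |μ.real C.1| ≤ μ.real Set.univ := by
    rw [abs_of_nonneg measureReal_nonneg]
    exact measureReal_mono (Set.subset_univ _)
  have h2 : |ν C.1| ≤ ν.totalVariation.real Set.univ :=
    (ν.norm_le_totalVariation C.1).trans (measureReal_mono (Set.subset_univ _))
  exact (abs_sub _ _).trans (add_le_add h1 h2)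

end

/-! Write ∇θ(0) = i m; the vector m is real because θ_n(-ζ) is the conjugate of θ_n(ζ). Take T with
TᵗT = K⁻¹ and let R bound the form K⁻¹. The map T sends ν_n to the standard Gaussian corrected by
the factor 1 + ⟨y, T m⟩/√t_n. At 2πζ, the characteristic function of T X_n/√t_n is exp(-2π²|ζ|²)
θ_n(Sζ), where S = 2πTᵗ/√t_n has norm at most s = 2π√R/√t_n. The two characteristic functions thus
differ by exp(-2π²|ζ|²) H(ζ), with H = f ∘ S and f(u) = θ_n(u) - 1 - i⟨u, m⟩. The function f
vanishes at 0, its gradient there has a small norm r, and its derivatives of orders 2 to d+1 are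
bounded by some M on the ball of radius B. By Taylor's formula and the chain rule, the derivatives
of H up to order d+1 are at most (r s + M s²)(1+|ζ|)² for |ζ| ≤ B/s
(`norm_iteratedFDeriv_comp_clm_le_of_taylor`).

Since H is controlled only on that ball, both laws are smoothed by a kernel whose Fourier transform
is supported in the ball of radius L = B/s. On any Borel set the smoothed laws differ by at most the
L¹ norm of a Fourier transform. As (1+|w|)^(-d-1) is integrable on ℝ^d, d+1 derivatives control this
norm, which is O(r s + M s²) (`exists_integral_norm_fourier_gaussian_mul_le`). Removing the
smoothing (`abs_measureReal_sub_le_of_conv`) costs the Gaussian mass of a shell of width of order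
1/L around a convex set. This is O(s/B) uniformly in the set: by convexity, a line meets in length
at most l the points that leave the set after a shift by l (`lintegral_convex_exit_le`).

After multiplication by √t_n the error is O(r + M s + 1/B). Fixing B large, then letting n grow,
makes it small, with constants that depend only on the data listed in the second assertion. The
first assertion follows by reading these data off the given sequence. -/

/-! ### Gaussian-type mass of the shells of convex sets. -/

section Shells

variable {V : Type*} [NormedAddCommGroup V] [InnerProductSpace ℝ V]

/-- On a line, the points of a convex set which leave it after a shift of length `l` form a set of
diameter at most `l`. -/
theorem volume_line_exit_le {D : Set V} (hD : Convex ℝ D) (x v : V) {l : ℝ} (hl : 0 ≤ l) :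
    volume {r : ℝ | x - r • v ∈ D ∧ x - r • v + l • v ∉ D} ≤ ENNReal.ofReal l := by
  refine (Real.volume_le_diam _).trans ?_
  refine Metric.ediam_le fun a ha b hb => ?_
  rw [edist_dist, Real.dist_eq]
  refine ENNReal.ofReal_le_ofReal ?_
  have key : ∀ a b : ℝ, (x - a • v ∈ D ∧ x - a • v + l • v ∉ D) →
      (x - b • v ∈ D ∧ x - b • v + l • v ∉ D) → a - b ≤ l := by
    intro a b ha hb
    by_contra! h
    -- If a - b > l, the shifted point x - a v + l v lies on the segment between two points of D.
    refine ha.2 (hD.segment_subset ha.1 hb.1 ?_)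
    have hab : 0 < a - b := hl.trans_lt h
    refine ⟨1 - l / (a - b), l / (a - b), ?_, by positivity, by ring, ?_⟩
    · rw [sub_nonneg, div_le_one hab]; exact h.le
    · have h1 : l / (a - b) * (a - b) = l := div_mul_cancel₀ _ hab.ne'
      have h2 : (1 - l / (a - b)) • (x - a • v) + (l / (a - b)) • (x - b • v)
          = x - a • v + (l / (a - b) * (a - b)) • v := by
        module
      rw [h2, h1]
  exact abs_sub_le_iff.2 ⟨key a b ha hb, key b a hb ha⟩

variable [FiniteDimensional ℝ V]

/-- The norm of a linear form is bounded by its largest coordinate. -/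
theorem exists_coord_ge_norm [Nontrivial V] (f : StrongDual ℝ V) :
    ∃ i, ‖f‖ ≤ Module.finrank ℝ V * |f (stdOrthonormalBasis ℝ V i)| := by
  set b := stdOrthonormalBasis ℝ V
  have hne : (Finset.univ : Finset (Fin (Module.finrank ℝ V))).Nonempty :=
    ⟨⟨0, Module.finrank_pos⟩, Finset.mem_univ _⟩
  obtain ⟨i, -, hi⟩ := Finset.exists_max_image Finset.univ (fun i => |f (b i)|) hne
  refine ⟨i, f.opNorm_le_bound (by positivity) fun x => ?_⟩
  have hx : f x = ∑ j, ⟪b j, x⟫ * f (b j) := by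
    conv_lhs => rw [← b.sum_repr' x]
    simp
  rw [hx]
  calc ‖∑ j, ⟪b j, x⟫ * f (b j)‖ ≤ ∑ _j : Fin (Module.finrank ℝ V), ‖x‖ * |f (b i)| := by
        refine norm_sum_le_of_le _ fun j _ => ?_
        rw [norm_mul, Real.norm_eq_abs, Real.norm_eq_abs]
        refine mul_le_mul ?_ (hi j (Finset.mem_univ j)) (abs_nonneg _) (norm_nonneg _)
        simpa using abs_real_inner_le_norm (b j) x
    _ = _ := by simp; ring

/-- The points of `D` that leave `D` after a shift by `± l` in some coordinate direction. -/
def coordExit (D : Set V) (l : ℝ) : Set V :=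
  ⋃ i, ({x | x ∈ D ∧ x + l • stdOrthonormalBasis ℝ V i ∉ D} ∪
    {x | x ∈ D ∧ x + l • (-stdOrthonormalBasis ℝ V i) ∉ D})

/-- Along some coordinate vector, suitably signed, f grows at rate at least ‖f‖/dim; a shift by dim
· δ then raises f by δ‖f‖, which is impossible inside D. -/
theorem mem_coordExit [Nontrivial V] {D : Set V} {x : V} {δ : ℝ} (hδ : 0 ≤ δ) (hx : x ∈ D)
    (f : StrongDual ℝ V) (hf : ∀ z ∈ D, f z < f x + δ * ‖f‖) :
    x ∈ coordExit D (Module.finrank ℝ V * δ) := by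
  obtain ⟨i, hi⟩ := exists_coord_ge_norm f
  refine Set.mem_iUnion.2 ⟨i, ?_⟩
  set e := stdOrthonormalBasis ℝ V i
  have h : ∀ e' : V, f e' = |f e| → x + (Module.finrank ℝ V * δ) • e' ∉ D := by
    intro e' he hmem
    have := hf _ hmem
    rw [map_add, map_smul, he, smul_eq_mul] at this
    nlinarith [mul_le_mul_of_nonneg_left hi hδ]
  rcases le_total 0 (f e) with h0 | h0
  · exact Or.inl ⟨hx, h e (abs_of_nonneg h0).symm⟩
  · exact Or.inr ⟨hx, h (-e) (by rw [map_neg, abs_of_nonpos h0])⟩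

/-- A functional f separating x from the closure is below f x on C, hence below f x + δ‖f‖ on the
thickening. -/
theorem thickening_diff_closure_subset [Nontrivial V] {C : Set V} (hC : Convex ℝ C) {δ : ℝ}
    (hδ : 0 < δ) :
    Metric.thickening δ C \ closure C
      ⊆ coordExit (Metric.thickening δ C) (Module.finrank ℝ V * δ) := by
  rintro x ⟨hx, hxC⟩
  obtain ⟨f, u, hfu, hux⟩ := geometric_hahn_banach_closed_point hC.closure isClosed_closure hxC
  refine mem_coordExit hδ.le hx f fun z hz => ?_
  obtain ⟨c, hc, hzc⟩ := Metric.mem_thickening_iff.1 hz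
  have h1 : f c < u := hfu c (subset_closure hc)
  have h2 : f z - f c ≤ ‖f‖ * δ := by
    rw [← map_sub]
    refine (le_abs_self _).trans ((f.le_opNorm _).trans ?_)
    rw [← dist_eq_norm]
    gcongr
  linarith

/-- Here f separates the interior from a point z outside C with dist x z < δ, so f is below f z ≤ f
x + δ‖f‖ on the interior. -/
theorem interior_diff_erosion_subset [Nontrivial V] {C : Set V} (hC : Convex ℝ C) {δ : ℝ}
    (hδ : 0 < δ) :
    interior C \ (Metric.thickening δ Cᶜ)ᶜ
      ⊆ coordExit (interior C) (Module.finrank ℝ V * δ) := by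
  rintro x ⟨hx, hxC⟩
  rw [Set.notMem_compl_iff] at hxC
  obtain ⟨z, hz, hxz⟩ := Metric.mem_thickening_iff.1 hxC
  obtain ⟨f, hf⟩ := geometric_hahn_banach_open_point hC.interior isOpen_interior
    (fun h => hz (interior_subset h))
  refine mem_coordExit hδ.le hx f fun a ha => ?_
  have h2 : f z - f x ≤ ‖f‖ * δ := by
    rw [← map_sub]
    refine (le_abs_self _).trans ((f.le_opNorm _).trans ?_)
    rw [← dist_eq_norm, dist_comm]
    gcongr
  linarith [hf a ha]

variable [MeasurableSpace V] [BorelSpace V]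

/-- The points of a convex set which leave it after a shift of length `l` in a given direction
carry a mass of order `l`. -/
theorem lintegral_convex_exit_le {D : Set V} (hD : Convex ℝ D) (hDm : MeasurableSet D) (v : V)
    {l : ℝ} (hl : 0 ≤ l) {F G : V → ENNReal} (hG : Measurable G)
    (hFG : ∀ x, ∀ r ∈ Set.Icc (0 : ℝ) 1, F x ≤ G (x + r • v)) :
    ∫⁻ x in {x | x ∈ D ∧ x + l • v ∉ D}, F x ≤ ENNReal.ofReal l * ∫⁻ x, G x := by
  set W : Set V := {x | x ∈ D ∧ x + l • v ∉ D} with hW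
  have hWm : MeasurableSet W :=
    hDm.inter (measurableSet_preimage (measurable_id.add_const _) hDm).compl
  have hI : volume (Set.Icc (0 : ℝ) 1) = 1 := by simp
  -- Averaging over the translations by r v, 0 ≤ r ≤ 1, avoids splitting the space along v. After
  -- Fubini, the inner integral is at most the length of {r | x - r v ∈ W}, hence at most l.
  calc ∫⁻ x in W, F x
      = ∫⁻ _r in Set.Icc (0 : ℝ) 1, ∫⁻ x in W, F x := by
        rw [lintegral_const, Measure.restrict_apply_univ, hI, mul_one]
    _ ≤ ∫⁻ r in Set.Icc (0 : ℝ) 1, ∫⁻ x, W.indicator 1 (x - r • v) * G x := by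
        refine setLIntegral_mono' measurableSet_Icc fun r hr => ?_
        rw [← lintegral_indicator hWm,
          ← lintegral_add_right_eq_self (fun x => W.indicator 1 (x - r • v) * G x) (r • v)]
        refine lintegral_mono fun x => ?_
        by_cases hx : x ∈ W
        · simpa [hx] using hFG x r hr
        · simp [hx]
    _ = ∫⁻ x, ∫⁻ r in Set.Icc (0 : ℝ) 1, W.indicator 1 (x - r • v) * G x := by
        rw [lintegral_lintegral_swap]
        refine Measurable.aemeasurable (Measurable.mul ?_ (hG.comp measurable_snd))
        exact (measurable_one.indicator hWm).comp (by fun_prop)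
    _ ≤ ∫⁻ x, ENNReal.ofReal l * G x := by
        refine lintegral_mono fun x => ?_
        have hm : Measurable fun r : ℝ => W.indicator (1 : V → ENNReal) (x - r • v) :=
          (measurable_one.indicator hWm).comp (by fun_prop)
        rw [lintegral_mul_const _ hm]
        gcongr
        refine (setLIntegral_le_lintegral _ _).trans ?_
        have : (fun r : ℝ => W.indicator (1 : V → ENNReal) (x - r • v))
            = ((fun r : ℝ => x - r • v) ⁻¹' W).indicator 1 := by
          ext r; rfl
        rw [this, lintegral_indicator_one (measurableSet_preimage (by fun_prop) hWm)]
        exact volume_line_exit_le hD x v hl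
    _ = ENNReal.ofReal l * ∫⁻ x, G x := lintegral_const_mul _ hG

/-- Union bound over the 2 · dim signed directions; the same G serves all of them. -/
theorem measure_coordExit_le {q : Measure V} {F G : V → ENNReal}
    (hG : Measurable G) (hq : q ≤ volume.withDensity F)
    (hFG : ∀ x v : V, ‖v‖ ≤ 1 → F x ≤ G (x + v)) {D : Set V} (hD : Convex ℝ D)
    (hDm : IsOpen D) {l : ℝ} (hl : 0 ≤ l) :
    q (coordExit D l) ≤ Module.finrank ℝ V * (2 * (ENNReal.ofReal l * ∫⁻ x, G x)) := by
  have key : ∀ v : V, ‖v‖ ≤ 1 →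
      q {x | x ∈ D ∧ x + l • v ∉ D} ≤ ENNReal.ofReal l * ∫⁻ x, G x := by
    intro v hv
    have hm : MeasurableSet {x | x ∈ D ∧ x + l • v ∉ D} := hDm.measurableSet.inter
      (measurableSet_preimage (measurable_id.add_const _) hDm.measurableSet).compl
    refine (hq _).trans ?_
    rw [withDensity_apply _ hm]
    refine lintegral_convex_exit_le hD hDm.measurableSet v hl hG fun x r hr => hFG _ _ ?_
    rw [norm_smul, Real.norm_eq_abs, abs_of_nonneg hr.1]
    exact mul_le_one₀ hr.2 (norm_nonneg _) hv
  refine (measure_iUnion_le _).trans ?_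
  rw [tsum_fintype]
  refine (Finset.sum_le_card_nsmul _ _ (2 * (ENNReal.ofReal l * ∫⁻ x, G x)) fun i _ => ?_).trans
    (by simp)
  refine (measure_union_le _ _).trans ?_
  rw [two_mul]
  exact add_le_add (key _ (by simp)) (key _ (by simp))

/-- The mass of the outer shell of a convex set. -/
theorem measure_thickening_le [Nontrivial V] {q : Measure V} {F G : V → ENNReal}
    (hG : Measurable G) (hq : q ≤ volume.withDensity F)
    (hFG : ∀ x v : V, ‖v‖ ≤ 1 → F x ≤ G (x + v)) {C : Set V} (hC : Convex ℝ C)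
    {δ : ℝ} (hδ : 0 < δ) :
    q (Metric.thickening δ C) ≤ q C + Module.finrank ℝ V *
      (2 * (ENNReal.ofReal (Module.finrank ℝ V * δ) * ∫⁻ x, G x)) := by
  have hac : q ≪ volume := (Measure.absolutelyContinuous_of_le hq).trans
    (withDensity_absolutelyContinuous _ _)
  -- The frontier of a convex set is Lebesgue-null, so only the points off the closure matter.
  have h0 : q (frontier C) = 0 := hac (hC.addHaar_frontier volume)
  calc q (Metric.thickening δ C)
      ≤ q (C ∪ frontier C ∪ (Metric.thickening δ C \ closure C)) := by
        refine measure_mono fun x hx => ?_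
        by_cases hxc : x ∈ closure C
        · exact Or.inl ((closure_eq_self_union_frontier C) ▸ hxc)
        · exact Or.inr ⟨hx, hxc⟩
    _ ≤ q C + q (frontier C) + q (Metric.thickening δ C \ closure C) :=
        (measure_union_le _ _).trans (add_le_add_left (measure_union_le _ _) _)
    _ ≤ _ := by
        rw [h0, add_zero]
        gcongr
        exact (measure_mono (thickening_diff_closure_subset hC hδ)).trans
          (measure_coordExit_le hG hq hFG (hC.thickening δ) Metric.isOpen_thickening (by positivity))

/-- The mass of the inner shell of a convex set. -/
theorem measure_le_erosion [Nontrivial V] {q : Measure V} {F G : V → ENNReal}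
    (hG : Measurable G) (hq : q ≤ volume.withDensity F)
    (hFG : ∀ x v : V, ‖v‖ ≤ 1 → F x ≤ G (x + v)) {C : Set V} (hC : Convex ℝ C)
    {δ : ℝ} (hδ : 0 < δ) :
    q C ≤ q (Metric.thickening δ Cᶜ)ᶜ + Module.finrank ℝ V *
      (2 * (ENNReal.ofReal (Module.finrank ℝ V * δ) * ∫⁻ x, G x)) := by
  have hac : q ≪ volume := (Measure.absolutelyContinuous_of_le hq).trans
    (withDensity_absolutelyContinuous _ _)
  have h0 : q (frontier C) = 0 := hac (hC.addHaar_frontier volume)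
  calc q C
      ≤ q ((Metric.thickening δ Cᶜ)ᶜ ∪ frontier C ∪
          (interior C \ (Metric.thickening δ Cᶜ)ᶜ)) := by
        refine measure_mono fun x hx => ?_
        by_cases hxc : x ∈ interior C
        · by_cases h : x ∈ (Metric.thickening δ Cᶜ)ᶜ
          · exact Or.inl (Or.inl h)
          · exact Or.inr ⟨hxc, h⟩
        · exact Or.inl (Or.inr ⟨subset_closure hx, hxc⟩)
    _ ≤ q (Metric.thickening δ Cᶜ)ᶜ + q (frontier C)
          + q (interior C \ (Metric.thickening δ Cᶜ)ᶜ) :=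
        (measure_union_le _ _).trans (add_le_add_left (measure_union_le _ _) _)
    _ ≤ _ := by
        rw [h0, add_zero]
        gcongr
        exact (measure_mono (interior_diff_erosion_subset hC hδ)).trans
          (measure_coordExit_le hG hq hFG hC.interior isOpen_interior (by positivity))

end Shells

/-! ### The smoothing inequality. -/

section Smoothing

variable {V : Type*} [NormedAddCommGroup V] [NormedSpace ℝ V] [MeasurableSpace V] [BorelSpace V]
  [SecondCountableTopology V]

theorem integrable_measureReal_translate (p ρ : Measure V) [IsFiniteMeasure p] [IsFiniteMeasure ρ]
    {C : Set V} (hC : MeasurableSet C) :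
    Integrable (fun x => p.real ((fun y => y + x) ⁻¹' C)) ρ := by
  refine Integrable.of_bound (C := p.real Set.univ) ?_ (ae_of_all _ fun x => ?_)
  · have h : MeasurableSet ((fun z : V × V => z.1 + z.2) ⁻¹' C) :=
      measurableSet_preimage measurable_add hC
    exact (measurable_measure_prodMk_right h).ennreal_toReal.aestronglyMeasurable
  · rw [Real.norm_eq_abs, abs_of_nonneg measureReal_nonneg]
    exact measureReal_mono (Set.subset_univ _)

theorem measureReal_conv (p ρ : Measure V) [IsFiniteMeasure p] [IsFiniteMeasure ρ]
    {C : Set V} (hC : MeasurableSet C) :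
    (p ∗ ρ).real C = ∫ x, p.real ((fun y => y + x) ⁻¹' C) ∂ρ := by
  have h : MeasurableSet ((fun z : V × V => z.1 + z.2) ⁻¹' C) :=
    measurableSet_preimage measurable_add hC
  rw [measureReal_def, Measure.conv, Measure.map_apply measurable_add hC,
    Measure.prod_apply_symm h]
  rw [← integral_toReal (measurable_measure_prodMk_right h).aemeasurable
    (ae_of_all _ fun x => measure_lt_top _ _)]
  rfl

/-- The erosion is the intersection of the translates C - v over ‖v‖ < δ. -/
theorem convex_erosion {C : Set V} (hC : Convex ℝ C) (δ : ℝ) :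
    Convex ℝ (Metric.thickening δ Cᶜ)ᶜ := by
  have hmem : ∀ x, x ∈ (Metric.thickening δ Cᶜ)ᶜ ↔ ∀ v : V, ‖v‖ < δ → x + v ∈ C := by
    intro x
    rw [Set.mem_compl_iff, Metric.mem_thickening_iff]
    push Not
    constructor
    · intro h v hv
      by_contra hx
      have := h (x + v) hx
      rw [dist_self_add_right] at this
      linarith
    · intro h z hz
      by_contra! hlt
      refine hz ?_
      have := h (z - x) (by rwa [← dist_eq_norm, dist_comm])
      rwa [add_sub_cancel] at this
  intro x hx y hy a b ha hb hab
  rw [hmem] at hx hy ⊢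
  intro v hv
  have := hC (hx v hv) (hy v hv) ha hb hab
  have e : a • (x + v) + b • (y + v) = a • x + b • y + (a + b) • v := by module
  rwa [e, hab, one_smul] at this

/-- Divide by a, using 1/a ≤ 4/3 and (1-a)/a ≤ 1/3. The coefficient of γ is below 1, so a supremum
in the role of γ can be absorbed. -/
theorem abs_sub_le_of_le_one_third {β a γ c : ℝ} (ha : 3 / 4 ≤ a) (hc : 0 ≤ c)
    (hγ : 0 ≤ γ) {s : ℝ} (h : a * (β - s) - (1 - a) * γ ≤ c) :
    β ≤ 4 / 3 * c + s + γ / 3 := by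
  by_contra! hlt
  have h1 : a * (β - s) ≥ a * (4 / 3 * c + γ / 3) := by
    refine mul_le_mul_of_nonneg_left ?_ (by linarith)
    linarith
  have h2 : a * (4 / 3 * c + γ / 3) - (1 - a) * γ ≥ c := by nlinarith
  nlinarith

/-- The smoothing inequality for convex sets: a kernel which is concentrated near the origin does
not change much the distance between a measure and another one which gives a small mass to the
shells of the convex sets. -/
theorem abs_measureReal_sub_le_of_conv (p q ρ : Measure V) [IsFiniteMeasure p] [IsFiniteMeasure q]
    [IsProbabilityMeasure ρ] {ε Δ S : ℝ} (hρ : 3 / 4 ≤ ρ.real (Metric.ball 0 ε))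
    (hΔ : ∀ C : Set V, MeasurableSet C → Convex ℝ C → |(p ∗ ρ).real C - (q ∗ ρ).real C| ≤ Δ)
    (hout : ∀ C : Set V, Convex ℝ C →
      q.real (Metric.thickening (2 * ε) C) ≤ q.real C + S)
    (hin : ∀ C : Set V, Convex ℝ C →
      q.real C ≤ q.real (Metric.thickening (2 * ε) Cᶜ)ᶜ + S)
    {C : Set V} (hCm : MeasurableSet C) (hC : Convex ℝ C) :
    |p.real C - q.real C| ≤ 2 * Δ + 3 / 2 * S := by
  set 𝒞 := {C : Set V // MeasurableSet C ∧ Convex ℝ C}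
  -- Translations outside the ball are controlled only by the supremum γ itself. It is finite, so
  -- the final inequality γ ≤ 4/3 Δ + S + γ/3 can be solved for γ.
  set γ : ℝ := ⨆ C : 𝒞, |p.real C.1 - q.real C.1| with hγdef
  have hbdd : BddAbove (Set.range fun C : 𝒞 => |p.real C.1 - q.real C.1|) := by
    refine ⟨p.real Set.univ + q.real Set.univ, ?_⟩
    rintro _ ⟨C, rfl⟩
    refine (abs_sub _ _).trans ?_
    rw [abs_of_nonneg measureReal_nonneg, abs_of_nonneg measureReal_nonneg]
    exact add_le_add (measureReal_mono (Set.subset_univ _)) (measureReal_mono (Set.subset_univ _))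
  have hle : ∀ C : Set V, MeasurableSet C → Convex ℝ C → |p.real C - q.real C| ≤ γ :=
    fun C h1 h2 => le_ciSup hbdd (⟨C, h1, h2⟩ : 𝒞)
  have hγ0 : 0 ≤ γ := (abs_nonneg _).trans (hle C hCm hC)
  have hΔ0 : 0 ≤ Δ := (abs_nonneg _).trans (hΔ C hCm hC)
  set a := ρ.real (Metric.ball 0 ε) with ha
  have hac : ρ.real (Metric.ball 0 ε)ᶜ = 1 - a := by
    rw [measureReal_compl Metric.isOpen_ball.measurableSet]; simp [ha]
  have htr : ∀ (C : Set V) (x : V), MeasurableSet C → Convex ℝ C →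
      MeasurableSet ((fun y => y + x) ⁻¹' C) ∧ Convex ℝ ((fun y => y + x) ⁻¹' C) := by
    intro C x h1 h2
    refine ⟨measurableSet_preimage (measurable_id.add_const _) h1, ?_⟩
    exact h2.translate_preimage_left x
  have hint : ∀ (C : Set V), MeasurableSet C →
      (p ∗ ρ).real C - (q ∗ ρ).real C =
        (∫ x in Metric.ball 0 ε,
          (p.real ((fun y => y + x) ⁻¹' C) - q.real ((fun y => y + x) ⁻¹' C)) ∂ρ) +
        ∫ x in (Metric.ball 0 ε)ᶜ,
          (p.real ((fun y => y + x) ⁻¹' C) - q.real ((fun y => y + x) ⁻¹' C)) ∂ρ := by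
    intro C hC
    have h1 := integrable_measureReal_translate p ρ hC
    have h2 := integrable_measureReal_translate q ρ hC
    rw [measureReal_conv p ρ hC, measureReal_conv q ρ hC, ← integral_sub h1 h2]
    exact (integral_add_compl Metric.isOpen_ball.measurableSet (h1.sub h2)).symm
  -- The ball contributes at least a β, its complement at least -(1-a) γ.
  have hlow : ∀ (C : Set V) (β : ℝ), MeasurableSet C → Convex ℝ C →
      (∀ x ∈ Metric.ball (0 : V) ε,
        β ≤ p.real ((fun y => y + x) ⁻¹' C) - q.real ((fun y => y + x) ⁻¹' C)) →
      a * β - (1 - a) * γ ≤ Δ := by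
    intro C β h1 h2 hβ
    have hI := (integrable_measureReal_translate p ρ h1).sub
      (integrable_measureReal_translate q ρ h1)
    have e1 : a * β ≤ ∫ x in Metric.ball 0 ε,
          (p.real ((fun y => y + x) ⁻¹' C) - q.real ((fun y => y + x) ⁻¹' C)) ∂ρ := by
      have := setIntegral_mono_on (μ := ρ) (s := Metric.ball 0 ε) (f := fun _ => β)
        integrableOn_const hI.integrableOn
        Metric.isOpen_ball.measurableSet hβ
      simpa [ha] using this
    have e2 : -((1 - a) * γ) ≤ ∫ x in (Metric.ball 0 ε)ᶜ,
          (p.real ((fun y => y + x) ⁻¹' C) - q.real ((fun y => y + x) ⁻¹' C)) ∂ρ := by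
      have := setIntegral_mono_on (μ := ρ) (s := (Metric.ball 0 ε)ᶜ) (f := fun _ => -γ)
        integrableOn_const hI.integrableOn
        Metric.isOpen_ball.measurableSet.compl
        (fun x _ => (abs_le.1 (hle _ (htr C x h1 h2).1 (htr C x h1 h2).2)).1)
      simpa [hac] using this
    have := (le_abs_self _).trans (hΔ C h1 h2)
    rw [hint C h1] at this
    linarith
  have hupp : ∀ (C : Set V) (β : ℝ), MeasurableSet C → Convex ℝ C →
      (∀ x ∈ Metric.ball (0 : V) ε,
        β ≤ q.real ((fun y => y + x) ⁻¹' C) - p.real ((fun y => y + x) ⁻¹' C)) →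
      a * β - (1 - a) * γ ≤ Δ := by
    intro C β h1 h2 hβ
    have hI := (integrable_measureReal_translate p ρ h1).sub
      (integrable_measureReal_translate q ρ h1)
    have e1 : (∫ x in Metric.ball 0 ε,
          (p.real ((fun y => y + x) ⁻¹' C) - q.real ((fun y => y + x) ⁻¹' C)) ∂ρ) ≤ -(a * β) := by
      have := setIntegral_mono_on (μ := ρ) (s := Metric.ball 0 ε) (g := fun _ => -β)
        hI.integrableOn integrableOn_const
        Metric.isOpen_ball.measurableSet (fun x hx => by
          have := hβ x hx
          simp only [Pi.sub_apply]
          linarith)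
      simpa [ha] using this
    have e2 : (∫ x in (Metric.ball 0 ε)ᶜ,
          (p.real ((fun y => y + x) ⁻¹' C) - q.real ((fun y => y + x) ⁻¹' C)) ∂ρ)
          ≤ (1 - a) * γ := by
      have := setIntegral_mono_on (μ := ρ) (s := (Metric.ball 0 ε)ᶜ) (g := fun _ => γ)
        hI.integrableOn integrableOn_const
        Metric.isOpen_ball.measurableSet.compl
        (fun x _ => (abs_le.1 (hle _ (htr C x h1 h2).1 (htr C x h1 h2).2)).2)
      simpa [hac] using this
    have := (abs_le.1 (hΔ C h1 h2)).1
    rw [hint C h1] at this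
    linarith
  have hmain : ∀ C : 𝒞, |p.real C.1 - q.real C.1| ≤ 4 / 3 * Δ + S + γ / 3 := by
    rintro ⟨C, hCm, hC⟩
    refine abs_sub_le_iff.2 ⟨?_, ?_⟩
    · refine abs_sub_le_of_le_one_third hρ hΔ0 hγ0 ?_
      -- For ‖x‖ < ε, the translate by -x of the ε-thickening contains C and lies in the
      -- 2ε-thickening.
      refine hlow (Metric.thickening ε C) _ Metric.isOpen_thickening.measurableSet
        (hC.thickening ε) fun x hx => ?_
      rw [mem_ball_zero_iff] at hx
      have h1 : p.real C ≤ p.real ((fun y => y + x) ⁻¹' Metric.thickening ε C) := by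
        refine measureReal_mono fun y hy => Metric.mem_thickening_iff.2 ⟨y, hy, ?_⟩
        rwa [dist_self_add_left]
      have h2 : q.real ((fun y => y + x) ⁻¹' Metric.thickening ε C)
          ≤ q.real (Metric.thickening (2 * ε) C) := by
        refine measureReal_mono fun y hy => ?_
        obtain ⟨z, hz, hyz⟩ := Metric.mem_thickening_iff.1 hy
        refine Metric.mem_thickening_iff.2 ⟨z, hz, ?_⟩
        have := dist_triangle y (y + x) z
        rw [dist_self_add_right] at this
        linarith
      linarith [hout C hC]
    · refine abs_sub_le_of_le_one_third hρ hΔ0 hγ0 ?_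
      -- Dually, the translate of the ε-erosion lies in C and contains the 2ε-erosion.
      refine hupp (Metric.thickening ε Cᶜ)ᶜ _ Metric.isOpen_thickening.measurableSet.compl
        (convex_erosion hC ε) fun x hx => ?_
      rw [mem_ball_zero_iff] at hx
      have h1 : p.real ((fun y => y + x) ⁻¹' (Metric.thickening ε Cᶜ)ᶜ) ≤ p.real C := by
        refine measureReal_mono fun y hy => ?_
        by_contra hyC
        refine hy (Metric.mem_thickening_iff.2 ⟨y, hyC, ?_⟩)
        rwa [dist_self_add_left]
      have h2 : q.real (Metric.thickening (2 * ε) Cᶜ)ᶜ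
          ≤ q.real ((fun y => y + x) ⁻¹' (Metric.thickening ε Cᶜ)ᶜ) := by
        refine measureReal_mono fun y hy hyx => hy ?_
        obtain ⟨z, hz, hyz⟩ := Metric.mem_thickening_iff.1 hyx
        refine Metric.mem_thickening_iff.2 ⟨z, hz, ?_⟩
        have := dist_triangle y (y + x) z
        rw [dist_self_add_right] at this
        linarith
      linarith [hin C hC]
  have hne : Nonempty 𝒞 := ⟨⟨C, hCm, hC⟩⟩
  have := ciSup_le hmain
  have := hle C hCm hC
  linarith

end Smoothing

/-! ### A probability density with compactly supported Fourier transform. -/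

section Kernel

open FourierTransform Convolution ContinuousLinearMap

variable {V : Type*} [NormedAddCommGroup V] [InnerProductSpace ℝ V] [FiniteDimensional ℝ V]
  [MeasurableSpace V] [BorelSpace V]

variable (V) in
-- The symmetry makes the Fourier transform real; the radius 1/2 keeps the self-convolution in the
-- unit ball.
theorem exists_symmetric_bump :
    ∃ f : V → ℂ, ContDiff ℝ (⊤ : ℕ∞) f ∧ HasCompactSupport f ∧ (∀ x, f x ≠ 0 → ‖x‖ < 1 / 2) ∧
      (∀ x, (starRingEnd ℂ) (f (-x)) = f x) ∧ 𝓕 f 0 ≠ 0 := by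
  obtain ⟨φ, hφ⟩ : ∃ φ : ContDiffBump (0 : V), φ.rOut = 1 / 2 :=
    ⟨⟨1 / 4, 1 / 2, by norm_num, by norm_num⟩, rfl⟩
  refine ⟨fun x => (φ x : ℂ), Complex.ofRealCLM.contDiff.comp φ.contDiff,
    φ.hasCompactSupport.comp_left (g := ((↑) : ℝ → ℂ)) rfl, fun x hx => ?_, fun x => ?_, ?_⟩
  · have : x ∈ Function.support φ := fun h => hx (by simp [h])
    rw [φ.support_eq, hφ] at this
    exact mem_ball_zero_iff.1 this
  · rw [Complex.conj_ofReal, φ.neg x]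
  · rw [Real.fourier_eq']
    simp only [inner_zero_right, mul_zero, Complex.ofReal_zero, zero_mul, Complex.exp_zero,
      one_smul]
    rw [integral_complex_ofReal, Complex.ofReal_ne_zero]
    exact φ.integral_pos.ne'

variable (V) in
/-- There is a smooth compactly supported function whose Fourier transform is nonnegative and
integrable, with a positive integral. -/
theorem exists_smooth_fourier_nonneg :
    ∃ (g : V → ℂ) (h : V → ℝ), ContDiff ℝ (⊤ : ℕ∞) g ∧ HasCompactSupport g ∧
      (∀ ζ, 1 < ‖ζ‖ → g ζ = 0) ∧ (∀ w, 0 ≤ h w) ∧ Integrable h ∧ 0 < ∫ w, h w ∧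
      ∀ w, 𝓕 g w = (h w : ℂ) := by
  obtain ⟨f, hf, hfc, hf1, hfs, hf0⟩ := exists_symmetric_bump V
  have hfi : Integrable f := hf.continuous.integrable_of_hasCompactSupport hfc
  obtain ⟨F, hF⟩ : ∃ F : SchwartzMap V ℂ, ∀ w, F w = 𝓕 f w :=
    ⟨𝓕 (hfc.toSchwartzMap hf), fun w => by rw [SchwartzMap.fourier_coe]; rfl⟩
  have hreal : ∀ w, ((F w).re : ℂ) = F w := fun w => by
    refine Complex.conj_eq_iff_re.1 ?_
    rw [hF, Real.fourier_eq', ← integral_conj, ← integral_neg_eq_self]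
    refine integral_congr_ae (ae_of_all _ fun x => ?_)
    simp [hfs, ← Complex.exp_conj, map_ofNat]
  have hcont : Continuous fun w => (F w).re ^ 2 :=
    (Complex.continuous_re.comp F.continuous).pow 2
  have hint : Integrable fun w => (F w).re ^ 2 := by
    have h2 : MemLp (fun w => (F w).re) 2 volume := (F.memLp 2).re
    exact h2.integrable_sq
  -- Self-convolution squares the real transform F, which gives positivity; F is a Schwartz
  -- function, so its square is integrable.
  refine ⟨f ⋆[mul ℂ ℂ] f, fun w => (F w).re ^ 2, ?_, hfc.convolution _ hfc, fun ζ hζ => ?_,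
    fun w => sq_nonneg _, hint, ?_, fun w => ?_⟩
  · have := hfc.contDiff_convolution_right (𝕜 := ℝ) (mul ℝ ℂ) (f := f) (μ := volume)
      (hfi.locallyIntegrable) hf
    have e : f ⋆[mul ℂ ℂ, volume] f = f ⋆[mul ℝ ℂ, volume] f := by ext x; simp [convolution]
    rw [e]; exact this
  · by_contra h
    obtain ⟨x, hx, y, hy, rfl⟩ := support_convolution_subset (mul ℂ ℂ) (μ := volume) h
    have := norm_add_le x y
    linarith [hf1 x hx, hf1 y hy]
  · rw [integral_pos_iff_support_of_nonneg (fun w => sq_nonneg _) hint]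
    refine (hcont.isOpen_support).measure_pos _ ⟨0, ?_⟩
    rw [← hF, ← hreal] at hf0
    exact pow_ne_zero 2 (Complex.ofReal_ne_zero.1 hf0)
  · rw [Real.fourier_mul_convolution_eq hfi hfi w, ← hF, ← hreal w]
    push_cast
    simp [sq]

variable (V) in
/-- There is a smooth compactly supported function whose Fourier transform is a probability
density. -/
theorem exists_smooth_fourier_density :
    ∃ (ψ : V → ℂ) (k : V → ℝ), ContDiff ℝ (⊤ : ℕ∞) ψ ∧ HasCompactSupport ψ ∧
      (∀ ζ, 1 < ‖ζ‖ → ψ ζ = 0) ∧ (∀ w, 0 ≤ k w) ∧ Integrable k ∧ ∫ w, k w = 1 ∧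
      ∀ w, 𝓕 ψ w = (k w : ℂ) := by
  obtain ⟨g, h, hgs, hgc, hg0, hh0, hhi, hpos, hgh⟩ := exists_smooth_fourier_nonneg V
  set c : ℝ := ∫ w, h w with hc
  refine ⟨fun ζ => (c⁻¹ : ℂ) • g ζ, fun w => c⁻¹ * h w, contDiff_const.fun_smul hgs,
    hgc.smul_left (f := fun _ => (c⁻¹ : ℂ)), fun ζ hζ => by simp [hg0 ζ hζ],
    fun w => mul_nonneg (inv_nonneg.2 hpos.le) (hh0 w), hhi.const_mul _, ?_, fun w => ?_⟩
  · rw [integral_const_mul, ← hc, inv_mul_cancel₀ hpos.ne']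
  · have : 𝓕 (fun ζ => (c⁻¹ : ℂ) • g ζ) w = (c⁻¹ : ℂ) • 𝓕 g w := by
      rw [Real.fourier_eq', Real.fourier_eq', ← integral_smul]
      refine integral_congr_ae (ae_of_all _ fun x => ?_)
      simp only [smul_eq_mul]; ring
    rw [this, hgh]
    push_cast
    rfl

theorem fourier_comp_inv_smul (ψ : V → ℂ) {L : ℝ} (hL : 0 < L) (w : V) :
    𝓕 (fun ζ => ψ (L⁻¹ • ζ)) w = (L : ℂ) ^ Module.finrank ℝ V * 𝓕 ψ (L • w) := by
  rw [Real.fourier_eq', Real.fourier_eq']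
  have := Measure.integral_comp_inv_smul volume
    (fun ζ => Complex.exp (((-2 * Real.pi * ⟪ζ, L • w⟫ : ℝ) : ℂ) * Complex.I) • ψ ζ) L
  have h2 : ∀ ζ, ⟪L⁻¹ • ζ, L • w⟫ = ⟪ζ, w⟫ := fun ζ => by
    rw [inner_smul_left, inner_smul_right]
    simp only [conj_trivial]
    field_simp
  simp only [h2] at this
  rw [this, abs_of_pos (by positivity), Complex.real_smul]
  push_cast
  rfl

end Kernel

/-! ### Smoothed measures through their characteristic functions. -/

section ConvDensity

open FourierTransform

variable {V : Type*} [NormedAddCommGroup V] [InnerProductSpace ℝ V] [FiniteDimensional ℝ V]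
  [MeasurableSpace V] [BorelSpace V]

/-- Fubini. The factor 2π reconciles exp(i⟨x, ζ⟩) in `charFun` with exp(-2πi⟨x, ζ⟩) in `𝓕`. When 𝓕 ψ
is a kernel k, the right side is the density of m convolved with k. -/
theorem fourier_mul_charFun (m : Measure V) [IsFiniteMeasure m] {ψ : V → ℂ} (hψ : Integrable ψ)
    (z : V) :
    𝓕 (fun ζ => ψ ζ * charFun m ((2 * Real.pi) • ζ)) z = ∫ y, 𝓕 ψ (z - y) ∂m := by
  simp_rw [Real.fourier_eq', charFun_apply]
  rw [integral_integral_swap]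
  · refine integral_congr_ae (ae_of_all _ fun ζ => ?_)
    simp only
    rw [← integral_const_mul, smul_eq_mul, ← integral_const_mul]
    refine integral_congr_ae (ae_of_all _ fun y => ?_)
    simp only [smul_eq_mul]
    rw [inner_smul_right, real_inner_comm ζ y, inner_sub_right, mul_left_comm, mul_comm (ψ ζ), ← Complex.exp_add]
    congr 2
    push_cast
    ring
  · have : Integrable (fun p : V × V => ψ p.2) (m.prod volume) := hψ.comp_snd m
    refine this.mono ?_ (ae_of_all _ fun p => ?_)
    · refine AEStronglyMeasurable.smul (f := fun p : V × V =>
        Complex.exp (((-2 * Real.pi * ⟪p.2, z - p.1⟫ : ℝ) : ℂ) * Complex.I))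
        (Continuous.aestronglyMeasurable ?_) this.aestronglyMeasurable
      fun_prop
    · rw [Function.uncurry_def, norm_smul, Complex.norm_exp_ofReal_mul_I, one_mul]

theorem conv_withDensity_eq (m : Measure V) [IsFiniteMeasure m] {k : V → ℝ} (hk : Measurable k) :
    m ∗ (volume.withDensity fun x => ENNReal.ofReal (k x))
      = volume.withDensity fun z => ∫⁻ y, ENNReal.ofReal (k (z - y)) ∂m := by
  have hmeas : Measurable fun p : V × V => ENNReal.ofReal (k (p.1 - p.2)) :=
    (hk.comp (measurable_fst.sub measurable_snd)).ennreal_ofReal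
  ext C hC
  rw [withDensity_apply _ hC, ← lintegral_indicator_one hC,
    Measure.lintegral_conv (measurable_one.indicator hC),
    lintegral_lintegral_swap (μ := volume.restrict C) (ν := m)
      (f := fun a y => ENNReal.ofReal (k (a - y))) hmeas.aemeasurable]
  refine lintegral_congr fun y => ?_
  have hm : Measurable fun a => C.indicator (1 : V → ENNReal) (y + a) :=
    (measurable_one.indicator hC).comp (measurable_const_add y)
  rw [lintegral_withDensity_eq_lintegral_mul _ hk.ennreal_ofReal hm,
    ← lintegral_indicator hC]
  simp only [Pi.mul_apply]
  rw [← lintegral_sub_right_eq_self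
    (fun x => ENNReal.ofReal (k x) * C.indicator (1 : V → ENNReal) (y + x)) y]
  refine lintegral_congr fun x => ?_
  by_cases hx : x ∈ C <;> simp [hx]

/-- The density of a measure convolved with a kernel, as a Fourier transform. -/
theorem measureReal_conv_withDensity (m : Measure V) [IsFiniteMeasure m] {ψ : V → ℂ}
    (hψ : Integrable ψ) {k : V → ℝ} (hk0 : ∀ w, 0 ≤ k w) (hki : Integrable k)
    (hk : ∀ w, 𝓕 ψ w = (k w : ℂ)) :
    Integrable (𝓕 (fun ζ => ψ ζ * charFun m ((2 * Real.pi) • ζ))) ∧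
    ∀ C : Set V, MeasurableSet C →
      ((m ∗ (volume.withDensity fun x => ENNReal.ofReal (k x))).real C : ℂ)
        = ∫ z in C, 𝓕 (fun ζ => ψ ζ * charFun m ((2 * Real.pi) • ζ)) z := by
  have hkc : Continuous k := by
    have h1 : Continuous (𝓕 ψ) := VectorFourier.fourierIntegral_continuous
      Real.continuous_fourierChar (by exact continuous_inner) hψ
    have : k = fun w => (𝓕 ψ w).re := by ext w; rw [hk]; simp
    rw [this]
    exact Complex.continuous_re.comp h1
  have hmeas : Measurable fun p : V × V => ENNReal.ofReal (k (p.1 - p.2)) :=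
    (hkc.measurable.comp (measurable_fst.sub measurable_snd)).ennreal_ofReal
  have hρ : IsFiniteMeasure (volume.withDensity fun x => ENNReal.ofReal (k x)) :=
    isFiniteMeasure_withDensity_ofReal hki.2
  set D : V → ENNReal := fun z => ∫⁻ y, ENNReal.ofReal (k (z - y)) ∂m with hD
  have hDm : Measurable D := hmeas.lintegral_prod_right'
  have hDF : ∀ z, 𝓕 (fun ζ => ψ ζ * charFun m ((2 * Real.pi) • ζ)) z = ((D z).toReal : ℂ) := by
    intro z
    rw [fourier_mul_charFun m hψ]
    simp_rw [hk]
    rw [integral_complex_ofReal, integral_eq_lintegral_of_nonneg_ae (ae_of_all _ fun y => hk0 _)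
      (Continuous.aestronglyMeasurable (by fun_prop))]
  have hconv := conv_withDensity_eq m hkc.measurable
  -- Integrability of the transform comes from positivity: it is the density of a finite measure.
  have hDfin : ∫⁻ z, D z ≠ ⊤ := by
    have : (m ∗ (volume.withDensity fun x => ENNReal.ofReal (k x))) Set.univ = ∫⁻ z, D z := by
      rw [hconv, withDensity_apply _ MeasurableSet.univ, Measure.restrict_univ]
    rw [← this]
    exact measure_ne_top _ _
  have hDlt : ∀ᵐ z, D z < ⊤ := ae_lt_top hDm hDfin
  have hI : Integrable fun z => ((D z).toReal : ℂ) :=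
    (integrable_toReal_of_lintegral_ne_top hDm.aemeasurable hDfin).ofReal
  have hfun : 𝓕 (fun ζ => ψ ζ * charFun m ((2 * Real.pi) • ζ)) = fun z => ((D z).toReal : ℂ) :=
    funext hDF
  rw [hfun]
  refine ⟨hI, fun C hC => ?_⟩
  rw [integral_complex_ofReal, integral_toReal hDm.aemeasurable (ae_restrict_of_ae hDlt),
    ← withDensity_apply _ hC, ← hconv]
  rfl

/-- The difference of the smoothed measures has as density the Fourier transform on the right, whose
L¹ norm bounds its integral over every C at once. -/
theorem abs_conv_sub_le (p q : Measure V) [IsFiniteMeasure p] [IsFiniteMeasure q] {ψ : V → ℂ}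
    (hψ : Integrable ψ) {k : V → ℝ} (hk0 : ∀ w, 0 ≤ k w) (hki : Integrable k)
    (hk : ∀ w, 𝓕 ψ w = (k w : ℂ)) {C : Set V} (hC : MeasurableSet C) :
    |(p ∗ (volume.withDensity fun x => ENNReal.ofReal (k x))).real C -
      (q ∗ (volume.withDensity fun x => ENNReal.ofReal (k x))).real C| ≤
    ∫ z, ‖𝓕 (fun ζ => ψ ζ * (charFun p ((2 * Real.pi) • ζ) - charFun q ((2 * Real.pi) • ζ))) z‖ := by
  obtain ⟨hp1, hp2⟩ := measureReal_conv_withDensity p hψ hk0 hki hk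
  obtain ⟨hq1, hq2⟩ := measureReal_conv_withDensity q hψ hk0 hki hk
  have hmul : ∀ (m : Measure V) [IsFiniteMeasure m],
      Integrable fun ζ => ψ ζ * charFun m ((2 * Real.pi) • ζ) := by
    intro m _
    refine hψ.mul_bdd (c := m.real Set.univ) ?_ (ae_of_all _ fun ζ => norm_charFun_le _)
    exact (measurable_charFun.comp (measurable_const_smul _)).aestronglyMeasurable
  have hsub : ∀ z, 𝓕 (fun ζ => ψ ζ * (charFun p ((2 * Real.pi) • ζ) -
      charFun q ((2 * Real.pi) • ζ))) z = 𝓕 (fun ζ => ψ ζ * charFun p ((2 * Real.pi) • ζ)) z -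
        𝓕 (fun ζ => ψ ζ * charFun q ((2 * Real.pi) • ζ)) z := by
    intro z
    rw [Real.fourier_eq, Real.fourier_eq, Real.fourier_eq, ← integral_sub]
    · simp only [mul_sub, smul_sub]
    · exact (Real.fourierIntegral_convergent_iff z).2 (hmul p)
    · exact (Real.fourierIntegral_convergent_iff z).2 (hmul q)
  rw [← Real.norm_eq_abs, ← Complex.norm_real, Complex.ofReal_sub, hp2 C hC, hq2 C hC,
    ← integral_sub hp1.integrableOn hq1.integrableOn]
  simp_rw [hsub]
  refine (norm_integral_le_integral_norm _).trans ?_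
  exact setIntegral_le_integral (hp1.sub hq1).norm (ae_of_all _ fun _ => norm_nonneg _)

end ConvDensity

/-! ### Derivatives of Gaussian functions. -/

section DerivativeBounds

theorem ContinuousLinearMap.norm_iteratedFDeriv_one {E F : Type*} [NormedAddCommGroup E]
    [NormedSpace ℝ E] [NormedAddCommGroup F] [NormedSpace ℝ F] (l : E →L[ℝ] F) (x : E) :
    ‖iteratedFDeriv ℝ 1 l x‖ = ‖l‖ := by
  rw [← norm_iteratedFDeriv_fderiv (n := 0), norm_iteratedFDeriv_zero, l.fderiv]

theorem ContinuousLinearMap.iteratedFDeriv_add_two {E F : Type*} [NormedAddCommGroup E]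
    [NormedSpace ℝ E] [NormedAddCommGroup F] [NormedSpace ℝ F] (l : E →L[ℝ] F) (n : ℕ) (x : E) :
    iteratedFDeriv ℝ (n + 2) l x = 0 := by
  have h : fderiv ℝ l = fun _ => l := by ext1 y; exact l.fderiv
  rw [← norm_eq_zero, ← norm_iteratedFDeriv_fderiv, h, iteratedFDeriv_succ_const]
  simp

variable {V : Type*} [NormedAddCommGroup V] [InnerProductSpace ℝ V]

theorem norm_iteratedFDeriv_id_le (n : ℕ) (x : V) :
    ‖iteratedFDeriv ℝ n (fun x : V => x) x‖ ≤ 1 + ‖x‖ := by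
  have h : (fun x : V => x) = ContinuousLinearMap.id ℝ V := rfl
  rw [h]
  match n with
  | 0 => rw [norm_iteratedFDeriv_zero]; simp
  | 1 =>
    rw [ContinuousLinearMap.norm_iteratedFDeriv_one]
    linarith [norm_nonneg x, ContinuousLinearMap.norm_id_le (𝕜 := ℝ) (E := V)]
  | n + 2 => rw [ContinuousLinearMap.iteratedFDeriv_add_two]; simp; positivity

theorem norm_iteratedFDeriv_norm_sq_le (n : ℕ) (x : V) :
    ‖iteratedFDeriv ℝ n (fun x : V => ‖x‖ ^ 2) x‖ ≤ 2 ^ n * (1 + ‖x‖) ^ 2 := by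
  have h : (fun x : V => ‖x‖ ^ 2) = fun x => innerSL ℝ x x := by
    ext x; simp
  rw [h]
  refine ((innerSL ℝ).norm_iteratedFDeriv_le_of_bilinear_of_le_one (N := n) contDiff_id contDiff_id
    x le_rfl (norm_innerSL_le ℝ)).trans ?_
  calc _ ≤ ∑ i ∈ Finset.range (n + 1), (n.choose i : ℝ) * (1 + ‖x‖) * (1 + ‖x‖) := by
        gcongr
        · exact norm_iteratedFDeriv_id_le _ x
        · exact norm_iteratedFDeriv_id_le _ x
    _ = _ := by
        rw [← Finset.sum_mul, ← Finset.sum_mul, ← Nat.cast_sum, Nat.sum_range_choose]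
        push_cast; ring

theorem one_add_pow_mul_exp_le (c : ℝ) (hc : 0 < c) (M : ℕ) :
    ∃ C, 0 ≤ C ∧ ∀ r : ℝ, 0 ≤ r → (1 + r) ^ M * Real.exp (-(c * r ^ 2)) ≤ C := by
  have h1 : Continuous fun r : ℝ => (1 + r) ^ M * Real.exp (-(c * r ^ 2)) := by fun_prop
  -- The constant comes from (1+r)² ≤ 2(1+r²) and y^M / M! ≤ exp y at y = c(1+r²).
  refine ⟨2 ^ M * (M.factorial / c ^ M) * Real.exp c, by positivity, fun r hr => ?_⟩
  have h2 : (1 + r) ^ M ≤ 2 ^ M * (1 + r ^ 2) ^ M := by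
    rw [← mul_pow]
    gcongr
    nlinarith [sq_nonneg (r - 1)]
  have h3 := Real.pow_div_factorial_le_exp (c * (1 + r ^ 2)) (by positivity) M
  have h4 : (1 + r ^ 2) ^ M ≤ (M.factorial / c ^ M) * Real.exp (c * (1 + r ^ 2)) := by
    rw [div_le_iff₀ (by positivity), mul_pow] at h3
    rw [div_mul_eq_mul_div, le_div_iff₀ (by positivity)]
    linarith
  calc (1 + r) ^ M * Real.exp (-(c * r ^ 2))
      ≤ 2 ^ M * ((M.factorial / c ^ M) * Real.exp (c * (1 + r ^ 2))) * Real.exp (-(c * r ^ 2)) := by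
        gcongr
        exact h2.trans (by gcongr)
    _ = 2 ^ M * (M.factorial / c ^ M) * (Real.exp (c * (1 + r ^ 2)) * Real.exp (-(c * r ^ 2))) := by
        ring
    _ = _ := by rw [← Real.exp_add]; congr 2; ring

theorem norm_iteratedFDeriv_exp (n : ℕ) (x : ℝ) :
    ‖iteratedFDeriv ℝ n Real.exp x‖ = Real.exp x := by
  rw [norm_iteratedFDeriv_eq_norm_iteratedDeriv, iteratedDeriv_eq_iterate, Real.iter_deriv_exp,
    Real.norm_eq_abs, Real.abs_exp]

theorem contDiff_gaussian (c : ℝ) {n : WithTop ℕ∞} :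
    ContDiff ℝ n fun x : V => Real.exp (-(c * ‖x‖ ^ 2)) :=
  Real.contDiff_exp.comp (contDiff_const.mul (contDiff_norm_sq ℝ)).neg

variable (V) in
/-- The derivatives of a Gaussian function decrease faster than any power. -/
theorem exists_norm_iteratedFDeriv_gaussian_le (c : ℝ) (hc : 0 < c) (N M : ℕ) :
    ∃ C, 0 ≤ C ∧ ∀ k ≤ N, ∀ x : V,
      ‖iteratedFDeriv ℝ k (fun x : V => Real.exp (-(c * ‖x‖ ^ 2))) x‖ ≤ C * ((1 + ‖x‖) ^ M)⁻¹ := by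
  -- At most N factors (1+‖x‖)² come from the chain rule, and M more powers are needed for the
  -- decay.
  obtain ⟨C, hC0, hC⟩ := one_add_pow_mul_exp_le c hc (2 * N + M)
  refine ⟨N.factorial * (2 * (1 + c)) ^ N * C, by positivity, fun k hk x => ?_⟩
  have hf : ContDiff ℝ k fun x : V => -(c * ‖x‖ ^ 2) :=
    (contDiff_const.mul (contDiff_norm_sq ℝ)).neg
  have hD : ∀ i, 1 ≤ i → i ≤ k → ‖iteratedFDeriv ℝ i (fun x : V => -(c * ‖x‖ ^ 2)) x‖
      ≤ (2 * (1 + c) * (1 + ‖x‖) ^ 2) ^ i := by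
    intro i hi _
    have e : (fun x : V => -(c * ‖x‖ ^ 2)) = fun x => (-c) • ‖x‖ ^ 2 := by ext; simp
    rw [e, iteratedFDeriv_const_smul_apply' (contDiff_norm_sq ℝ).contDiffAt, norm_smul, norm_neg,
      Real.norm_of_nonneg hc.le, mul_assoc, mul_pow]
    have h1 := norm_iteratedFDeriv_norm_sq_le i x
    have h2 : (1 : ℝ) ≤ (1 + ‖x‖) ^ 2 := one_le_pow₀ (by linarith [norm_nonneg x])
    have h3 : c * (1 + ‖x‖) ^ 2 ≤ ((1 + c) * (1 + ‖x‖) ^ 2) ^ i :=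
      calc c * (1 + ‖x‖) ^ 2 ≤ (1 + c) * (1 + ‖x‖) ^ 2 := by gcongr; linarith
        _ ≤ _ := le_self_pow₀ (by nlinarith) (by omega)
    calc c * ‖iteratedFDeriv ℝ i (fun x : V => ‖x‖ ^ 2) x‖
        ≤ c * (2 ^ i * (1 + ‖x‖) ^ 2) := by gcongr
      _ = 2 ^ i * (c * (1 + ‖x‖) ^ 2) := by ring
      _ ≤ _ := by gcongr
  -- Quantitative Faà di Bruno formula: the i-th derivative of the exponent is at most D^i with D =
  -- 2(1+c)(1+‖x‖)², and every derivative of exp is exp.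
  have hmain := norm_iteratedFDeriv_comp_le (n := k) (N := k) Real.contDiff_exp hf le_rfl x
    (fun i _ => (norm_iteratedFDeriv_exp i _).le) hD
  refine hmain.trans ?_
  have hx1 : (1 : ℝ) ≤ 1 + ‖x‖ := by linarith [norm_nonneg x]
  have hE := hC ‖x‖ (norm_nonneg x)
  rw [← div_eq_mul_inv, le_div_iff₀ (by positivity)]
  calc (k.factorial * Real.exp (-(c * ‖x‖ ^ 2)) * (2 * (1 + c) * (1 + ‖x‖) ^ 2) ^ k)
        * (1 + ‖x‖) ^ M
      ≤ (N.factorial * Real.exp (-(c * ‖x‖ ^ 2)) * (2 * (1 + c) * (1 + ‖x‖) ^ 2) ^ N)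
        * (1 + ‖x‖) ^ M := by
        have : (1 : ℝ) ≤ 2 * (1 + c) * (1 + ‖x‖) ^ 2 := by nlinarith
        have hfac : (k.factorial : ℝ) ≤ N.factorial := by exact_mod_cast Nat.factorial_le hk
        gcongr
    _ = N.factorial * (2 * (1 + c)) ^ N *
        ((1 + ‖x‖) ^ (2 * N + M) * Real.exp (-(c * ‖x‖ ^ 2))) := by
        rw [mul_pow _ ((1 + ‖x‖) ^ 2), ← pow_mul, pow_add]; ring
    _ ≤ _ := by gcongr

end DerivativeBounds

/-! ### L¹ bounds for Fourier transforms. -/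

section FourierL1

open FourierTransform

variable (V : Type*) [NormedAddCommGroup V] [InnerProductSpace ℝ V] [FiniteDimensional ℝ V]
  [MeasurableSpace V] [BorelSpace V]

theorem integrable_inv_one_add_norm_pow :
    Integrable fun x : V => ((1 + ‖x‖) ^ (Module.finrank ℝ V + 1))⁻¹ := by
  have := integrable_one_add_norm (E := V) (μ := volume)
    (r := ((Module.finrank ℝ V + 1 : ℕ) : ℝ)) (by push_cast; linarith)
  refine this.congr (ae_of_all _ fun x => ?_)
  simp only
  rw [Real.rpow_neg (by positivity), Real.rpow_natCast]

/-- The `L¹` norm of the Fourier transform is controlled by the derivatives of order at most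
`dim V + 1`. -/
theorem exists_integral_norm_fourier_le :
    ∃ C, 0 ≤ C ∧ ∀ (G : V → ℂ) (a : ℝ), ContDiff ℝ ((Module.finrank ℝ V + 1 : ℕ) : WithTop ℕ∞) G →
      (∀ k ≤ Module.finrank ℝ V + 1, ∀ ζ, ‖iteratedFDeriv ℝ k G ζ‖
        ≤ a * ((1 + ‖ζ‖) ^ (Module.finrank ℝ V + 1))⁻¹) →
      ∫ w, ‖𝓕 G w‖ ≤ C * a := by
  -- dim + 1 is the least integer exponent for which (1+‖x‖)^(-N) is integrable; hence the d+1
  -- derivatives of the hypothesis.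
  set N := Module.finrank ℝ V + 1 with hN
  have hI := integrable_inv_one_add_norm_pow V
  rw [← hN] at hI
  set I := ∫ x : V, ((1 + ‖x‖) ^ N)⁻¹ with hIdef
  have hI0 : 0 ≤ I := integral_nonneg fun x => by positivity
  refine ⟨2 ^ (N - 1) * (I + 2 ^ N * ((N + 1) * I)) * I, by positivity, fun G a hG hb => ?_⟩
  have hDint : ∀ k ≤ N, Integrable fun ζ => ‖iteratedFDeriv ℝ k G ζ‖ := by
    intro k hk
    refine (hI.const_mul a).mono'
      (hG.continuous_iteratedFDeriv (by exact_mod_cast hk)).norm.aestronglyMeasurable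
      (ae_of_all _ fun ζ => ?_)
    rw [norm_norm]
    exact hb k hk ζ
  have hDle : ∀ k ≤ N, ∫ ζ, ‖iteratedFDeriv ℝ k G ζ‖ ≤ a * I := by
    intro k hk
    rw [hIdef, ← integral_const_mul]
    exact integral_mono (hDint k hk) (hI.const_mul a) (hb k hk)
  -- Each power of w is paid for by one derivative of G; the cases n = 0 and n = N together bound
  -- (1+‖w‖)^N ‖𝓕 G w‖.
  have hpow : ∀ n ≤ N, ∀ w, ‖w‖ ^ n * ‖𝓕 G w‖ ≤ 2 ^ n * ((n + 1) * (a * I)) := by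
    intro n hn w
    have := Real.pow_mul_norm_iteratedFDeriv_fourier_le (K := 0) (N := N) (f := G)
      (by exact_mod_cast hG) (fun k n hk hn => by
        have hk0 : k = 0 := by simpa using hk
        subst hk0
        simpa using hDint n (by exact_mod_cast hn)) (k := 0) (n := n) (by simp)
        (by exact_mod_cast hn) w
    rw [norm_iteratedFDeriv_zero] at this
    refine this.trans ?_
    have hs : ∑ p ∈ Finset.range (0 + 1) ×ˢ Finset.range (n + 1),
        ∫ v, ‖v‖ ^ p.1 * ‖iteratedFDeriv ℝ p.2 G v‖ ≤ (n + 1) * (a * I) := by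
      refine (Finset.sum_le_card_nsmul _ _ (a * I) fun p hp => ?_).trans ?_
      · rw [Finset.mem_product, Finset.mem_range, Finset.mem_range] at hp
        have : p.1 = 0 := by omega
        simp only [this, pow_zero, one_mul]
        exact hDle _ (by omega)
      · simp
    simp only [pow_zero, one_mul, Nat.cast_zero, mul_zero, zero_add]
    gcongr
  have hptw : ∀ w, ‖𝓕 G w‖ ≤ 2 ^ (N - 1) * (I + 2 ^ N * ((N + 1) * I)) * a * ((1 + ‖w‖) ^ N)⁻¹ := by
    intro w
    have h0 := hpow 0 (Nat.zero_le _) w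
    have hN' := hpow N le_rfl w
    simp only [pow_zero, one_mul, CharP.cast_eq_zero, zero_add] at h0
    rw [← div_eq_mul_inv, le_div_iff₀ (by positivity)]
    have h2 := add_pow_le (zero_le_one) (norm_nonneg w) N
    rw [one_pow] at h2
    calc ‖𝓕 G w‖ * (1 + ‖w‖) ^ N ≤ ‖𝓕 G w‖ * (2 ^ (N - 1) * (1 + ‖w‖ ^ N)) := by gcongr
      _ = 2 ^ (N - 1) * (‖𝓕 G w‖ + ‖w‖ ^ N * ‖𝓕 G w‖) := by ring
      _ ≤ 2 ^ (N - 1) * (a * I + 2 ^ N * ((N + 1) * (a * I))) := by gcongr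
      _ = _ := by ring
  calc ∫ w, ‖𝓕 G w‖ ≤ ∫ w, 2 ^ (N - 1) * (I + 2 ^ N * ((N + 1) * I)) * a * ((1 + ‖w‖) ^ N)⁻¹ := by
        refine integral_mono_of_nonneg (ae_of_all _ fun _ => norm_nonneg _) (hI.const_mul _)
          (ae_of_all _ hptw)
    _ = _ := by rw [integral_const_mul]; ring

/-- The `L¹` norm of the Fourier transform of a truncated Gaussian multiplied by a small smooth
function. -/
theorem exists_integral_norm_fourier_gaussian_mul_le (c : ℝ) (hc : 0 < c) {ψ : V → ℂ}
    (hψ : ContDiff ℝ (⊤ : ℕ∞) ψ) (hψc : HasCompactSupport ψ) (hψ1 : ∀ ζ, 1 < ‖ζ‖ → ψ ζ = 0) :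
    ∃ C, 0 ≤ C ∧ ∀ (L κ : ℝ) (H : V → ℂ), 1 ≤ L →
      ContDiff ℝ ((Module.finrank ℝ V + 1 : ℕ) : WithTop ℕ∞) H →
      (∀ k ≤ Module.finrank ℝ V + 1, ∀ ζ, ‖ζ‖ ≤ L → ‖iteratedFDeriv ℝ k H ζ‖
        ≤ κ * (1 + ‖ζ‖) ^ 2) →
      ∫ w, ‖𝓕 (fun ζ => (Real.exp (-(c * ‖ζ‖ ^ 2)) • ψ (L⁻¹ • ζ)) * H ζ) w‖ ≤ C * κ := by
  obtain ⟨C₁, hC₁, hL1⟩ := exists_integral_norm_fourier_le V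
  set N := Module.finrank ℝ V + 1 with hN
  -- Two of the N + 2 powers absorb the growth (1+‖ζ‖)² of H; the other N give integrability.
  obtain ⟨C₂, hC₂, hgauss⟩ := exists_norm_iteratedFDeriv_gaussian_le V c hc N (N + 2)
  have hψb : ∀ k : ℕ, ∃ B, ∀ ζ, ‖iteratedFDeriv ℝ k ψ ζ‖ ≤ B := fun k =>
    (hψ.continuous_iteratedFDeriv (by exact_mod_cast le_top)).bounded_above_of_compact_support
      (hψc.iteratedFDeriv k)
  choose B hB using hψb
  have hB0 : ∀ k, 0 ≤ B k := fun k => (norm_nonneg _).trans (hB k 0)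
  set C₃ := ∑ k ∈ Finset.range (N + 1), B k with hC₃
  have hC₃0 : 0 ≤ C₃ := Finset.sum_nonneg fun k _ => hB0 k
  have hBC : ∀ k ≤ N, B k ≤ C₃ := fun k hk =>
    Finset.single_le_sum (f := B) (fun k _ => hB0 k) (Finset.mem_range.2 (by omega))
  refine ⟨C₁ * (2 ^ N * (2 ^ N * (C₂ * C₃))), by positivity, fun L κ H hL hH hHb => ?_⟩
  have hκ : 0 ≤ κ := by
    have := (norm_nonneg _).trans (hHb 0 (Nat.zero_le _) 0 (by simp; linarith))
    simpa using this
  have hψL : ContDiff ℝ N fun ζ => ψ (L⁻¹ • ζ) :=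
    (hψ.of_le (by exact_mod_cast le_top)).comp (contDiff_const_smul _)
  -- Since L ≥ 1, the factors L^(-k) are at most 1 and the bound does not depend on L.
  have hψLb : ∀ k ≤ N, ∀ ζ, ‖iteratedFDeriv ℝ k (fun ζ => ψ (L⁻¹ • ζ)) ζ‖ ≤ C₃ := by
    intro k hk ζ
    rw [iteratedFDeriv_comp_const_smul (i := k) L⁻¹ (hψ.of_le (by exact_mod_cast le_top)),
      norm_smul, norm_pow, norm_inv, Real.norm_of_nonneg (by linarith)]
    calc (L⁻¹) ^ k * ‖iteratedFDeriv ℝ k ψ (L⁻¹ • ζ)‖ ≤ 1 * C₃ := by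
          gcongr
          · exact pow_le_one₀ (by positivity) (inv_le_one_of_one_le₀ hL)
          · exact (hB k _).trans (hBC k hk)
      _ = C₃ := one_mul _
  set u : V → ℂ := fun ζ => Real.exp (-(c * ‖ζ‖ ^ 2)) • ψ (L⁻¹ • ζ) with hu
  have hus : ContDiff ℝ N u := (contDiff_gaussian c).smul hψL
  have hub : ∀ k ≤ N, ∀ ζ, ‖iteratedFDeriv ℝ k u ζ‖
      ≤ 2 ^ N * (C₂ * C₃) * ((1 + ‖ζ‖) ^ (N + 2))⁻¹ := by
    intro k hk ζ
    refine (norm_iteratedFDeriv_smul_le (N := N) (contDiff_gaussian c) hψL ζ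
      (by exact_mod_cast hk)).trans ?_
    calc _ ≤ ∑ i ∈ Finset.range (k + 1), (k.choose i : ℝ) *
          (C₂ * ((1 + ‖ζ‖) ^ (N + 2))⁻¹) * C₃ := by
          refine Finset.sum_le_sum fun i hi => ?_
          rw [Finset.mem_range] at hi
          gcongr
          · exact hgauss i (by omega) ζ
          · exact hψLb _ (by omega) ζ
      _ = 2 ^ k * (C₂ * C₃) * ((1 + ‖ζ‖) ^ (N + 2))⁻¹ := by
          rw [← Finset.sum_mul, ← Finset.sum_mul, ← Nat.cast_sum, Nat.sum_range_choose]
          push_cast; ring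
      _ ≤ _ := by gcongr; norm_num
  -- Nothing is known of the size of H beyond radius L, but there the product vanishes with all its
  -- derivatives.
  have hsupp : tsupport u ⊆ Metric.closedBall 0 L := by
    refine closure_minimal (fun ζ hζ => ?_) Metric.isClosed_closedBall
    rw [mem_closedBall_zero_iff]
    by_contra! h
    refine hζ ?_
    have : ψ (L⁻¹ • ζ) = 0 := by
      refine hψ1 _ ?_
      rw [norm_smul, norm_inv, Real.norm_of_nonneg (by linarith), inv_mul_eq_div,
        one_lt_div (by linarith)]
      exact h
    simp [hu, this]
  rw [mul_assoc]
  refine hL1 _ _ (hus.mul hH) fun k hk ζ => ?_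
  by_cases hζ : ‖ζ‖ ≤ L
  · refine (norm_iteratedFDeriv_mul_le hus hH ζ (by exact_mod_cast hk)).trans ?_
    calc _ ≤ ∑ i ∈ Finset.range (k + 1), (k.choose i : ℝ) *
          (2 ^ N * (C₂ * C₃) * ((1 + ‖ζ‖) ^ (N + 2))⁻¹) * (κ * (1 + ‖ζ‖) ^ 2) := by
          refine Finset.sum_le_sum fun i hi => ?_
          rw [Finset.mem_range] at hi
          gcongr
          · exact hub i (by omega) ζ
          · exact hHb _ (by omega) ζ hζ
      _ = 2 ^ k * (2 ^ N * (C₂ * C₃)) * κ * ((1 + ‖ζ‖) ^ N)⁻¹ := by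
          rw [← Finset.sum_mul, ← Finset.sum_mul, ← Nat.cast_sum, Nat.sum_range_choose]
          have : (1 : ℝ) + ‖ζ‖ ≠ 0 := by positivity
          push_cast
          field_simp
          ring
      _ ≤ _ := by gcongr; norm_num
  · have h0 : iteratedFDeriv ℝ k (fun ζ => u ζ * H ζ) ζ = 0 := by
      by_contra h
      have := support_iteratedFDeriv_subset k (Function.mem_support.2 h)
      have h2 := hsupp (closure_mono (Function.support_mul_subset_left u H) this)
      exact hζ (mem_closedBall_zero_iff.1 h2)
    rw [h0, norm_zero]
    positivity

end FourierL1

/-! ### Dilated kernels. -/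

section ScaledKernel

open FourierTransform

variable (V : Type*) [NormedAddCommGroup V] [InnerProductSpace ℝ V] [FiniteDimensional ℝ V]
  [MeasurableSpace V] [BorelSpace V]

variable {V} in
theorem measureReal_withDensity_ofReal {f : V → ℝ} (hf : Integrable f) (hf0 : ∀ x, 0 ≤ f x)
    {s : Set V} (hs : MeasurableSet s) :
    (volume.withDensity fun x => ENNReal.ofReal (f x)).real s = ∫ x in s, f x := by
  rw [measureReal_def, withDensity_apply _ hs,
    ← ofReal_integral_eq_lintegral_ofReal hf.integrableOn (ae_of_all _ hf0),
    ENNReal.toReal_ofReal (integral_nonneg hf0)]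

/-- Smoothing kernels with a compactly supported Fourier transform, at all the scales. -/
theorem exists_scaled_kernels :
    ∃ (ψ : V → ℂ) (a : ℝ), ContDiff ℝ (⊤ : ℕ∞) ψ ∧ HasCompactSupport ψ ∧
      (∀ ζ, 1 < ‖ζ‖ → ψ ζ = 0) ∧ 0 < a ∧ ∀ L : ℝ, 0 < L → ∃ k : V → ℝ, (∀ w, 0 ≤ k w) ∧
        Integrable k ∧ (∀ w, 𝓕 (fun ζ => ψ (L⁻¹ • ζ)) w = (k w : ℂ)) ∧
        IsProbabilityMeasure (volume.withDensity fun x => ENNReal.ofReal (k x)) ∧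
        3 / 4 ≤ (volume.withDensity fun x => ENNReal.ofReal (k x)).real (Metric.ball 0 (a / L)) := by
  obtain ⟨ψ, k, hψ, hψc, hψ1, hk0, hki, hk1, hψk⟩ := exists_smooth_fourier_density V
  -- The radius a carries 3/4 of the mass at scale 1; the dilation by L turns it into a / L.
  obtain ⟨a, ha, ha34⟩ : ∃ a : ℝ, 0 < a ∧ 3 / 4 ≤ ∫ x in Metric.ball 0 a, k x := by
    have hlim : Tendsto (fun n : ℕ => ∫ x in Metric.ball (0 : V) (n : ℝ), k x) atTop
        (𝓝 (∫ x in ⋃ n : ℕ, Metric.ball (0 : V) (n : ℝ), k x)) := by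
      refine tendsto_setIntegral_of_monotone (fun n => Metric.isOpen_ball.measurableSet) ?_
        hki.integrableOn
      intro n m hnm
      exact Metric.ball_subset_ball (by exact_mod_cast hnm)
    rw [Metric.iUnion_ball_nat, Measure.restrict_univ, hk1] at hlim
    obtain ⟨n, hn1, hn2⟩ := ((hlim.eventually (lt_mem_nhds (by norm_num : (3 : ℝ) / 4 < 1))).and
      (eventually_gt_atTop 0)).exists
    exact ⟨n, by exact_mod_cast hn2, hn1.le⟩
  refine ⟨ψ, a, hψ, hψc, hψ1, ha, fun L hL => ?_⟩
  set d := Module.finrank ℝ V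
  have hint : ∀ s : Set V, ∫ w in (fun w => L • w) ⁻¹' s, L ^ d * k (L • w) = ∫ w in s, k w := by
    intro s
    rw [integral_const_mul, Measure.setIntegral_comp_smul_of_pos volume k _ hL,
      smul_eq_mul, ← mul_assoc, mul_inv_cancel₀ (by positivity), one_mul]
    congr 2
    ext x
    rw [Set.mem_smul_set_iff_inv_smul_mem₀ hL.ne']
    simp [smul_inv_smul₀ hL.ne']
  have hki' : Integrable fun w => L ^ d * k (L • w) := (hki.comp_smul hL.ne').const_mul _
  have hk0' : ∀ w, 0 ≤ L ^ d * k (L • w) := fun w => mul_nonneg (by positivity) (hk0 _)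
  refine ⟨fun w => L ^ d * k (L • w), hk0', hki', fun w => ?_, ⟨?_⟩, ?_⟩
  · rw [fourier_comp_inv_smul ψ hL, hψk]; push_cast; rfl
  · have h1 := measureReal_withDensity_ofReal hki' hk0' MeasurableSet.univ
    have h2 := hint Set.univ
    rw [Set.preimage_univ, Measure.restrict_univ, hk1] at h2
    rw [Measure.restrict_univ, h2, measureReal_def] at h1
    exact (ENNReal.toReal_eq_one_iff _).1 h1
  · rw [measureReal_withDensity_ofReal hki' hk0' Metric.isOpen_ball.measurableSet]
    have : Metric.ball (0 : V) (a / L) = (fun w => L • w) ⁻¹' Metric.ball 0 a := by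
      ext w
      rw [Set.mem_preimage, mem_ball_zero_iff, mem_ball_zero_iff, norm_smul,
        Real.norm_of_nonneg hL.le, lt_div_iff₀ hL, mul_comm]
    rw [this, hint]
    exact ha34

end ScaledKernel

/-! ### The corrected standard Gaussian density and its Fourier transform. -/

section StandardDensity

variable {V : Type*} [NormedAddCommGroup V] [InnerProductSpace ℝ V] [FiniteDimensional ℝ V]
  [MeasurableSpace V] [BorelSpace V]

/-- The standard Gaussian density with a first-order correction. -/
noncomputable def correctedStdDensity (m y : V) : ℝ :=
  (Real.sqrt ((2 * Real.pi) ^ Module.finrank ℝ V))⁻¹ * Real.exp (-‖y‖ ^ 2 / 2) * (1 + ⟪y, m⟫)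

theorem integrable_exp_neg_mul_norm_sq {c : ℝ} (hc : 0 < c) :
    Integrable fun y : V => Real.exp (-(c * ‖y‖ ^ 2)) := by
  have h := (GaussianFourier.integrable_cexp_neg_mul_sq_norm_add (V := V) (b := (c : ℂ))
    (by simpa using hc) 0 0).norm
  refine h.congr (ae_of_all _ fun y => ?_)
  simp only [inner_zero_left, Complex.ofReal_zero, mul_zero, add_zero]
  rw [show -(c : ℂ) * (‖y‖ : ℂ) ^ 2 = ((-(c * ‖y‖ ^ 2) : ℝ) : ℂ) by push_cast; ring,
    Complex.norm_exp_ofReal]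

/-- Trades the polynomial factor for half of the Gaussian exponent. -/
theorem one_add_mul_exp_le {r : ℝ} :
    (1 + r) * Real.exp (-r ^ 2 / 2) ≤ 2 * Real.exp (-(1 / 4 * r ^ 2)) := by
  have h1 : 1 + r ≤ 2 * Real.exp (1 / 4 * r ^ 2) := by
    nlinarith [Real.add_one_le_exp (1 / 4 * r ^ 2), sq_nonneg (r - 1)]
  calc (1 + r) * Real.exp (-r ^ 2 / 2)
      ≤ 2 * Real.exp (1 / 4 * r ^ 2) * Real.exp (-r ^ 2 / 2) := by gcongr
    _ = _ := by rw [mul_assoc, ← Real.exp_add]; congr 2; ring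

theorem abs_correctedStdDensity_le (m y : V) :
    |correctedStdDensity m y| ≤ (Real.sqrt ((2 * Real.pi) ^ Module.finrank ℝ V))⁻¹ *
      (2 * (1 + ‖m‖)) * Real.exp (-(1 / 4 * ‖y‖ ^ 2)) := by
  have h1 : |1 + ⟪y, m⟫| ≤ (1 + ‖m‖) * (1 + ‖y‖) := by
    refine (abs_add_le _ _).trans ?_
    have := abs_real_inner_le_norm y m
    rw [abs_one]
    nlinarith [norm_nonneg y, norm_nonneg m]
  rw [correctedStdDensity, abs_mul, abs_mul, Real.abs_exp, abs_of_nonneg (by positivity)]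
  calc _ ≤ (Real.sqrt ((2 * Real.pi) ^ Module.finrank ℝ V))⁻¹ * Real.exp (-‖y‖ ^ 2 / 2) *
        ((1 + ‖m‖) * (1 + ‖y‖)) := by gcongr
    _ = (Real.sqrt ((2 * Real.pi) ^ Module.finrank ℝ V))⁻¹ * (1 + ‖m‖) *
        ((1 + ‖y‖) * Real.exp (-‖y‖ ^ 2 / 2)) := by ring
    _ ≤ (Real.sqrt ((2 * Real.pi) ^ Module.finrank ℝ V))⁻¹ * (1 + ‖m‖) *
        (2 * Real.exp (-(1 / 4 * ‖y‖ ^ 2))) := by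
        exact mul_le_mul_of_nonneg_left one_add_mul_exp_le (by positivity)
    _ = _ := by ring

theorem integrable_correctedStdDensity (m : V) : Integrable (correctedStdDensity m) := by
  refine ((integrable_exp_neg_mul_norm_sq (V := V) (c := 1 / 4) (by norm_num)).const_mul
    ((Real.sqrt ((2 * Real.pi) ^ Module.finrank ℝ V))⁻¹ * (2 * (1 + ‖m‖)))).mono' ?_
    (ae_of_all _ fun y => abs_correctedStdDensity_le m y)
  refine Continuous.aestronglyMeasurable ?_
  unfold correctedStdDensity
  fun_prop

theorem integral_cexp_gaussian (ξ : V) :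
    ∫ y : V, Real.exp (-‖y‖ ^ 2 / 2) * Complex.exp ((⟪y, ξ⟫ : ℂ) * Complex.I)
      = Real.sqrt ((2 * Real.pi) ^ Module.finrank ℝ V) * Complex.exp ((-‖ξ‖ ^ 2 / 2 : ℝ) : ℂ) := by
  have h := GaussianFourier.integral_cexp_neg_mul_sq_norm_add (V := V) (b := 1 / 2)
    (by norm_num) Complex.I ξ
  calc _ = ∫ v : V, Complex.exp (-(1 / 2 : ℂ) * (‖v‖ : ℂ) ^ 2 + Complex.I * (⟪ξ, v⟫ : ℂ)) := by
        refine integral_congr_ae (ae_of_all _ fun y => ?_)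
        simp only
        rw [Complex.ofReal_exp, ← Complex.exp_add, real_inner_comm]
        congr 1; push_cast; ring
    _ = _ := by
        rw [h]
        congr 1
        · rw [show ((Real.pi : ℂ) / (1 / 2)) = ((2 * Real.pi : ℝ) : ℂ) by push_cast; ring,
            Real.sqrt_eq_rpow, ← Real.rpow_natCast, ← Real.rpow_mul (by positivity),
            Complex.ofReal_cpow (by positivity)]
          congr 1; push_cast; ring
        · congr 1; push_cast; rw [Complex.I_sq]; ring

/-- Differentiate `integral_cexp_gaussian` along ξ + s m at s = 0; dominated convergence rests on
`one_add_mul_exp_le`. -/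
theorem integral_inner_cexp_gaussian (m ξ : V) :
    ∫ y : V, (⟪y, m⟫ : ℂ) * (Real.exp (-‖y‖ ^ 2 / 2) * Complex.exp ((⟪y, ξ⟫ : ℂ) * Complex.I))
      = Real.sqrt ((2 * Real.pi) ^ Module.finrank ℝ V) * Complex.exp ((-‖ξ‖ ^ 2 / 2 : ℝ) : ℂ) *
        (Complex.I * ⟪ξ, m⟫) := by
  set c : ℝ := Real.sqrt ((2 * Real.pi) ^ Module.finrank ℝ V)
  let F : ℝ → V → ℂ := fun s y =>
    Real.exp (-‖y‖ ^ 2 / 2) * Complex.exp ((⟪y, ξ + s • m⟫ : ℂ) * Complex.I)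
  let F' : ℝ → V → ℂ := fun s y => Real.exp (-‖y‖ ^ 2 / 2) *
    (Complex.exp ((⟪y, ξ + s • m⟫ : ℂ) * Complex.I) * ((⟪y, m⟫ : ℂ) * Complex.I))
  have hG := integrable_exp_neg_mul_norm_sq (V := V) (c := 1 / 4) (by norm_num)
  have hder : HasDerivAt (fun s => ∫ y, F s y) (∫ y, F' 0 y) 0 := by
    refine (hasDerivAt_integral_of_dominated_loc_of_deriv_le (μ := volume) (F := F) (F' := F')
      (bound := fun y => 2 * (1 + ‖m‖) * Real.exp (-(1 / 4 * ‖y‖ ^ 2))) (s := Set.univ) (x₀ := 0)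
      univ_mem (Eventually.of_forall fun s => ?_) ?_ ?_ (ae_of_all _ fun y s _ => ?_)
      (hG.const_mul _) (ae_of_all _ fun y s _ => ?_)).2
    · exact Continuous.aestronglyMeasurable (by fun_prop)
    · refine (integrable_exp_neg_mul_norm_sq (V := V) (c := 1 / 2) (by norm_num)).mono'
        (Continuous.aestronglyMeasurable (by fun_prop)) (ae_of_all _ fun y => ?_)
      simp only [F]
      rw [norm_mul, Complex.norm_exp_ofReal_mul_I, mul_one, Complex.norm_real, Real.norm_eq_abs,
        Real.abs_exp]
      exact (congrArg Real.exp (by ring)).le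
    · exact Continuous.aestronglyMeasurable (by fun_prop)
    · simp only [F']
      rw [norm_mul, norm_mul, Complex.norm_exp_ofReal_mul_I, one_mul, Complex.norm_real,
        Real.norm_eq_abs, Real.abs_exp, norm_mul, Complex.norm_I, mul_one, Complex.norm_real]
      have h1 := abs_real_inner_le_norm y m
      calc _ ≤ Real.exp (-‖y‖ ^ 2 / 2) * ((1 + ‖y‖) * (1 + ‖m‖)) := by
            gcongr
            rw [Real.norm_eq_abs]
            nlinarith [norm_nonneg y, norm_nonneg m]
        _ = (1 + ‖m‖) * ((1 + ‖y‖) * Real.exp (-‖y‖ ^ 2 / 2)) := by ring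
        _ ≤ (1 + ‖m‖) * (2 * Real.exp (-(1 / 4 * ‖y‖ ^ 2))) := by
            exact mul_le_mul_of_nonneg_left one_add_mul_exp_le (by positivity)
        _ = _ := by ring
    · have h1 : HasDerivAt (fun s : ℝ => ⟪y, ξ + s • m⟫) ⟪y, m⟫ s := by
        have : (fun s : ℝ => ⟪y, ξ + s • m⟫) = fun s => ⟪y, ξ⟫ + s * ⟪y, m⟫ := by
          ext s; rw [inner_add_right, inner_smul_right]
        rw [this]
        simpa using ((hasDerivAt_id s).mul_const ⟪y, m⟫).const_add ⟪y, ξ⟫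
      exact ((h1.ofReal_comp.mul_const Complex.I).cexp).const_mul _
  have hF : (fun s => ∫ y, F s y)
      = fun s : ℝ => c * Complex.exp ((-‖ξ + s • m‖ ^ 2 / 2 : ℝ) : ℂ) := by
    ext s; exact integral_cexp_gaussian _
  have hder2 : HasDerivAt (fun s : ℝ => (c : ℂ) * Complex.exp ((-‖ξ + s • m‖ ^ 2 / 2 : ℝ) : ℂ))
      (c * (Complex.exp ((-‖ξ‖ ^ 2 / 2 : ℝ) : ℂ) * ((-⟪ξ, m⟫ : ℝ) : ℂ))) 0 := by
    have h1 : HasDerivAt (fun s : ℝ => -‖ξ + s • m‖ ^ 2 / 2) (-⟪ξ, m⟫) 0 := by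
      have h2 : HasDerivAt (fun s : ℝ => ξ + s • m) m 0 := by
        simpa using ((hasDerivAt_id (0 : ℝ)).smul_const m).const_add ξ
      have h3 := (h2.norm_sq.neg).div_const 2
      refine h3.congr_deriv ?_
      rw [zero_smul, add_zero]; ring
    have := (h1.ofReal_comp.cexp).const_mul (c : ℂ)
    simpa using this
  rw [hF] at hder
  have huniq := hder.unique hder2
  have h0 : ∫ y, F' 0 y = Complex.I * ∫ y : V, (⟪y, m⟫ : ℂ) *
      (Real.exp (-‖y‖ ^ 2 / 2) * Complex.exp ((⟪y, ξ⟫ : ℂ) * Complex.I)) := by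
    rw [← integral_const_mul]
    refine integral_congr_ae (ae_of_all _ fun y => ?_)
    simp only [F', zero_smul, add_zero]
    ring
  rw [h0] at huniq
  have hI : Complex.I * (-Complex.I) = 1 := by simp
  calc _ = (-Complex.I) * (Complex.I * ∫ y : V, (⟪y, m⟫ : ℂ) *
      (Real.exp (-‖y‖ ^ 2 / 2) * Complex.exp ((⟪y, ξ⟫ : ℂ) * Complex.I))) := by
        rw [← mul_assoc, mul_comm (-Complex.I), hI, one_mul]
    _ = _ := by rw [huniq]; push_cast; ring

/-- The Fourier transform of the corrected Gaussian density. -/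
theorem integral_cexp_correctedStdDensity (m ξ : V) :
    ∫ y : V, (correctedStdDensity m y : ℂ) * Complex.exp ((⟪y, ξ⟫ : ℂ) * Complex.I)
      = Complex.exp ((-‖ξ‖ ^ 2 / 2 : ℝ) : ℂ) * (1 + Complex.I * ⟪ξ, m⟫) := by
  set c : ℝ := Real.sqrt ((2 * Real.pi) ^ Module.finrank ℝ V) with hc
  have hc0 : (c : ℂ) ≠ 0 := Complex.ofReal_ne_zero.2 (by positivity)
  have hI1 : Integrable fun y : V =>
      (Real.exp (-‖y‖ ^ 2 / 2) : ℂ) * Complex.exp ((⟪y, ξ⟫ : ℂ) * Complex.I) := by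
    refine (integrable_exp_neg_mul_norm_sq (V := V) (c := 1 / 2) (by norm_num)).mono'
        (Continuous.aestronglyMeasurable (by fun_prop)) (ae_of_all _ fun y => ?_)
    rw [norm_mul, Complex.norm_exp_ofReal_mul_I, mul_one, Complex.norm_real, Real.norm_eq_abs,
        Real.abs_exp]
    exact (congrArg Real.exp (by ring)).le
  have hI2 : Integrable fun y : V => (⟪y, m⟫ : ℂ) *
      ((Real.exp (-‖y‖ ^ 2 / 2) : ℂ) * Complex.exp ((⟪y, ξ⟫ : ℂ) * Complex.I)) := by
    refine ((integrable_exp_neg_mul_norm_sq (V := V) (c := 1 / 4)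
      (by norm_num)).const_mul (2 * (1 + ‖m‖))).mono'
        (Continuous.aestronglyMeasurable (by fun_prop)) (ae_of_all _ fun y => ?_)
    rw [norm_mul, norm_mul, Complex.norm_exp_ofReal_mul_I, mul_one, Complex.norm_real,
      Real.norm_eq_abs, Complex.norm_real, Real.norm_eq_abs, Real.abs_exp]
    have h1 := abs_real_inner_le_norm y m
    calc _ ≤ ((1 + ‖y‖) * (1 + ‖m‖)) * Real.exp (-‖y‖ ^ 2 / 2) := by
          gcongr
          nlinarith [norm_nonneg y, norm_nonneg m]
      _ = (1 + ‖m‖) * ((1 + ‖y‖) * Real.exp (-‖y‖ ^ 2 / 2)) := by ring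
      _ ≤ (1 + ‖m‖) * (2 * Real.exp (-(1 / 4 * ‖y‖ ^ 2))) := by
          exact mul_le_mul_of_nonneg_left one_add_mul_exp_le (by positivity)
      _ = _ := by ring
  calc _ = ∫ y : V, (c : ℂ)⁻¹ * ((Real.exp (-‖y‖ ^ 2 / 2) * Complex.exp ((⟪y, ξ⟫ : ℂ) * Complex.I))
        + (⟪y, m⟫ : ℂ) *
          (Real.exp (-‖y‖ ^ 2 / 2) * Complex.exp ((⟪y, ξ⟫ : ℂ) * Complex.I))) := by
        refine integral_congr_ae (ae_of_all _ fun y => ?_)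
        simp only [correctedStdDensity, ← hc]
        push_cast; ring
    _ = _ := by
        rw [integral_const_mul, integral_add hI1 hI2, integral_cexp_gaussian,
          integral_inner_cexp_gaussian, ← hc]
        field_simp

end StandardDensity

/-! ### Comparison with the corrected standard Gaussian. -/

section Core

open FourierTransform

variable {V : Type*} [NormedAddCommGroup V] [InnerProductSpace ℝ V] [FiniteDimensional ℝ V]
  [MeasurableSpace V] [BorelSpace V]

theorem ENNReal_toReal_shell_le {x y : ENNReal} {n : ℕ} {l A : ℝ} (hl : 0 ≤ l) (hA : 0 ≤ A)
    (hy : y ≠ ⊤) (h : x ≤ y + n * (2 * (ENNReal.ofReal l * ENNReal.ofReal A))) :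
    x.toReal ≤ y.toReal + n * (2 * (l * A)) := by
  have e : (n : ENNReal) * (2 * (ENNReal.ofReal l * ENNReal.ofReal A))
      = ENNReal.ofReal (n * (2 * (l * A))) := by
    rw [ENNReal.ofReal_mul (by positivity), ENNReal.ofReal_mul (by positivity),
      ENNReal.ofReal_mul hl]
    simp
  rw [e] at h
  refine (ENNReal.toReal_mono (ENNReal.add_ne_top.2 ⟨hy, ENNReal.ofReal_ne_top⟩) h).trans ?_
  rw [ENNReal.toReal_add hy ENNReal.ofReal_ne_top, ENNReal.toReal_ofReal (by positivity)]

variable (V) in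
/-- The mass given to the shells of convex sets by the corrected Gaussian density. -/
theorem exists_correctedStd_shell_le [Nontrivial V] :
    ∃ B, 0 ≤ B ∧ ∀ (m : V) (δ : ℝ), 0 < δ → ∀ C : Set V, Convex ℝ C →
      (volume.withDensity fun y => ENNReal.ofReal (correctedStdDensity m y)).real
        (Metric.thickening δ C) ≤
      (volume.withDensity fun y => ENNReal.ofReal (correctedStdDensity m y)).real C
        + B * (1 + ‖m‖) * δ ∧
      (volume.withDensity fun y => ENNReal.ofReal (correctedStdDensity m y)).real C ≤
      (volume.withDensity fun y => ENNReal.ofReal (correctedStdDensity m y)).real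
        (Metric.thickening δ Cᶜ)ᶜ + B * (1 + ‖m‖) * δ := by
  set d := Module.finrank ℝ V with hd
  set c := (Real.sqrt ((2 * Real.pi) ^ d))⁻¹ with hc
  have hc0 : 0 ≤ c := by positivity
  have hJ := integrable_exp_neg_mul_norm_sq (V := V) (c := 1 / 8) (by norm_num)
  set J := ∫ y : V, Real.exp (-(1 / 8 * ‖y‖ ^ 2)) with hJdef
  have hJ0 : 0 ≤ J := integral_nonneg fun y => (Real.exp_pos _).le
  refine ⟨d * (2 * (d * (c * 2 * Real.exp (1 / 4) * J))), by positivity, fun m δ hδ C hC => ?_⟩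
  set A : ℝ := c * (2 * (1 + ‖m‖)) with hA
  have hA0 : 0 ≤ A := by positivity
  set q := volume.withDensity fun y : V => ENNReal.ofReal (correctedStdDensity m y) with hq
  have hqfin : IsFiniteMeasure q :=
    isFiniteMeasure_withDensity_ofReal (integrable_correctedStdDensity m).2
  -- For ‖v‖ ≤ 1, ‖x + v‖² ≤ 2‖x‖² + 2. Halving the exponent 1/4 to 1/8 and paying exp(1/4) thus
  -- makes G dominate F over unit shifts.
  let F : V → ENNReal := fun y => ENNReal.ofReal (A * Real.exp (-(1 / 4 * ‖y‖ ^ 2)))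
  let G : V → ENNReal := fun y =>
    ENNReal.ofReal (A * Real.exp (1 / 4) * Real.exp (-(1 / 8 * ‖y‖ ^ 2)))
  have hG : Measurable G := by fun_prop
  have hqF : q ≤ volume.withDensity F := withDensity_mono (ae_of_all _ fun y =>
    ENNReal.ofReal_le_ofReal ((le_abs_self _).trans (abs_correctedStdDensity_le m y)))
  have hFG : ∀ x v : V, ‖v‖ ≤ 1 → F x ≤ G (x + v) := by
    intro x v hv
    refine ENNReal.ofReal_le_ofReal ?_
    rw [mul_assoc A (Real.exp _), ← Real.exp_add]
    gcongr
    have h1 := norm_add_le x v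
    have h2 : ‖x + v‖ ^ 2 ≤ (‖x‖ + 1) ^ 2 := by gcongr; linarith
    nlinarith [sq_nonneg (‖x‖ - 1)]
  have hGint : ∫⁻ y, G y = ENNReal.ofReal (A * Real.exp (1 / 4) * J) := by
    rw [hJdef, ← integral_const_mul, ofReal_integral_eq_lintegral_ofReal (hJ.const_mul _)
      (ae_of_all _ fun y => by positivity)]
  have h1 := measure_thickening_le hG hqF hFG hC hδ
  have h2 := measure_le_erosion hG hqF hFG hC hδ
  rw [hGint] at h1 h2
  have e : d * (2 * (d * (c * 2 * Real.exp (1 / 4) * J))) * (1 + ‖m‖) * δ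
      = d * (2 * ((d * δ) * (A * Real.exp (1 / 4) * J))) := by rw [hA]; ring
  rw [e]
  exact ⟨ENNReal_toReal_shell_le (by positivity) (by positivity) (measure_ne_top _ _) h1,
    ENNReal_toReal_shell_le (by positivity) (by positivity) (measure_ne_top _ _) h2⟩

theorem setIntegral_eq_posPart_sub_negPart {f : V → ℝ} (hf : Integrable f) {s : Set V}
    (hs : MeasurableSet s) :
    ∫ x in s, f x = (volume.withDensity fun x => ENNReal.ofReal (f x)).real s
      - (volume.withDensity fun x => ENNReal.ofReal (-f x)).real s := by
  rw [integral_eq_lintegral_pos_part_sub_lintegral_neg_part hf.integrableOn,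
    measureReal_def, measureReal_def, withDensity_apply _ hs, withDensity_apply _ hs]

theorem charFun_posPart_sub_negPart {f : V → ℝ} (hf : Integrable f) (hfm : Measurable f) (ξ : V) :
    charFun (volume.withDensity fun x => ENNReal.ofReal (f x)) ξ
      - charFun (volume.withDensity fun x => ENNReal.ofReal (-f x)) ξ
      = ∫ y : V, (f y : ℂ) * Complex.exp ((⟪y, ξ⟫ : ℂ) * Complex.I) := by
  have hint : ∀ g : V → ℝ, Integrable g →
      Integrable fun y => (g y : ℂ) * Complex.exp ((⟪y, ξ⟫ : ℂ) * Complex.I) := by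
    intro g hg
    refine hg.ofReal.mul_bdd (c := 1) (Continuous.aestronglyMeasurable (by fun_prop))
      (ae_of_all _ fun y => ?_)
    rw [Complex.norm_exp_ofReal_mul_I]
  have key : ∀ g : V → ℝ, Measurable g →
      charFun (volume.withDensity fun x => ENNReal.ofReal (g x)) ξ
      = ∫ y : V, ((max (g y) 0 : ℝ) : ℂ) * Complex.exp ((⟪y, ξ⟫ : ℂ) * Complex.I) := by
    intro g hg
    rw [charFun_apply, integral_withDensity_eq_integral_toReal_smul hg.ennreal_ofReal
      (ae_of_all _ fun _ => ENNReal.ofReal_lt_top)]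
    refine integral_congr_ae (ae_of_all _ fun y => ?_)
    simp only [ENNReal.toReal_ofReal', Complex.real_smul]
  have hneg : Integrable fun y => max (-f y) 0 := hf.neg.pos_part
  rw [key f hfm, key (fun x => -f x) hfm.neg,
    ← integral_sub (hint _ hf.pos_part) (hint _ hneg)]
  refine integral_congr_ae (ae_of_all _ fun y => ?_)
  simp only
  rw [← sub_mul, ← Complex.ofReal_sub, max_zero_sub_max_neg_zero_eq_self]

variable (V) in
/-- The distance on convex sets between a probability measure and a corrected Gaussian
distribution, when the characteristic functions are close on a large ball. -/
theorem exists_abs_sub_correctedStd_le [Nontrivial V] :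
    ∃ C₀, 0 ≤ C₀ ∧ ∀ (μ : Measure V) (m : V) (H : V → ℂ) (L κ : ℝ), IsProbabilityMeasure μ →
      1 ≤ L → ContDiff ℝ ((Module.finrank ℝ V + 1 : ℕ) : WithTop ℕ∞) H →
      (∀ k ≤ Module.finrank ℝ V + 1, ∀ ζ, ‖ζ‖ ≤ L → ‖iteratedFDeriv ℝ k H ζ‖
        ≤ κ * (1 + ‖ζ‖) ^ 2) →
      (∀ ζ, charFun μ ((2 * Real.pi) • ζ) = Complex.exp ((-(2 * Real.pi ^ 2 * ‖ζ‖ ^ 2) : ℝ) : ℂ) *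
        (1 + Complex.I * ⟪(2 * Real.pi) • ζ, m⟫ + H ζ)) →
      ∀ C : Set V, MeasurableSet C → Convex ℝ C →
        |μ.real C - ∫ y in C, correctedStdDensity m y| ≤ C₀ * (κ + (1 + ‖m‖) / L) := by
  obtain ⟨ψ, a, hψ, hψc, hψ1, ha, hker⟩ := exists_scaled_kernels V
  obtain ⟨C₁, hC₁, hfour⟩ := exists_integral_norm_fourier_gaussian_mul_le V (2 * Real.pi ^ 2)
    (by positivity) hψ hψc hψ1
  obtain ⟨B, hB, hshell⟩ := exists_correctedStd_shell_le V
  refine ⟨2 * C₁ + 3 / 2 * (B * (2 * a)), by positivity,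
    fun μ m H L κ hμ hL hH hHb hchar C hCm hC => ?_⟩
  have hL0 : 0 < L := by linarith
  have hκ : 0 ≤ κ := by
    have := (norm_nonneg _).trans (hHb 0 (Nat.zero_le _) 0 (by simp; linarith))
    simpa using this
  obtain ⟨k, hk0, hki, hψk, hkprob, hk34⟩ := hker L hL0
  set f := correctedStdDensity m with hf
  have hfi : Integrable f := integrable_correctedStdDensity m
  have hfm : Measurable f := by
    refine Continuous.measurable ?_
    rw [hf]; unfold correctedStdDensity; fun_prop
  set q := volume.withDensity fun y : V => ENNReal.ofReal (f y) with hq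
  -- The smoothing inequality needs positive measures, so the negative part n of the corrected
  -- density is added to μ. Then (μ + n) - q is μ minus the signed measure, and only the shells of
  -- the positive part q have to be small.
  set n := volume.withDensity fun y : V => ENNReal.ofReal (-f y) with hn
  have hqfin : IsFiniteMeasure q := isFiniteMeasure_withDensity_ofReal hfi.2
  have hnfin : IsFiniteMeasure n := isFiniteMeasure_withDensity_ofReal hfi.neg.2
  have hψL : Continuous fun ζ => ψ (L⁻¹ • ζ) := hψ.continuous.comp (continuous_const_smul _)
  have hψLi : Integrable fun ζ => ψ (L⁻¹ • ζ) :=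
    (hψ.continuous.integrable_of_hasCompactSupport hψc).comp_smul (inv_ne_zero hL0.ne')
  -- The transforms of q and n combine into that of the corrected Gaussian; only the Gaussian times
  -- H remains.
  have hdiff : ∀ ζ, ψ (L⁻¹ • ζ) * (charFun (μ + n) ((2 * Real.pi) • ζ)
      - charFun q ((2 * Real.pi) • ζ))
      = (Real.exp (-(2 * Real.pi ^ 2 * ‖ζ‖ ^ 2)) • ψ (L⁻¹ • ζ)) * H ζ := by
    intro ζ
    have h1 : charFun (μ + n) ((2 * Real.pi) • ζ)
        = charFun μ ((2 * Real.pi) • ζ) + charFun n ((2 * Real.pi) • ζ) := by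
      have hb : ∀ ν : Measure V, IsFiniteMeasure ν → Integrable (fun y : V =>
          Complex.exp ((⟪y, (2 * Real.pi) • ζ⟫ : ℂ) * Complex.I)) ν := by
        intro ν _
        refine Integrable.of_bound (C := 1) (Continuous.aestronglyMeasurable (by fun_prop))
          (ae_of_all _ fun y => ?_)
        rw [Complex.norm_exp_ofReal_mul_I]
      rw [charFun_apply, charFun_apply, charFun_apply, integral_add_measure (hb μ inferInstance)
        (hb n hnfin)]
    have h2 := charFun_posPart_sub_negPart hfi hfm ((2 * Real.pi) • ζ)
    rw [hf, integral_cexp_correctedStdDensity] at h2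
    have h3 : (-‖(2 * Real.pi) • ζ‖ ^ 2 / 2 : ℝ) = -(2 * Real.pi ^ 2 * ‖ζ‖ ^ 2) := by
      rw [norm_smul, Real.norm_of_nonneg (by positivity)]; ring
    rw [h3] at h2
    have h4 : charFun (μ + n) ((2 * Real.pi) • ζ) - charFun q ((2 * Real.pi) • ζ)
        = Complex.exp ((-(2 * Real.pi ^ 2 * ‖ζ‖ ^ 2) : ℝ) : ℂ) * H ζ := by
      rw [h1, hchar]
      linear_combination -h2
    rw [h4, Complex.real_smul, Complex.ofReal_exp]
    ring
  have hΔ : ∀ D : Set V, MeasurableSet D → Convex ℝ D →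
      |((μ + n) ∗ (volume.withDensity fun x => ENNReal.ofReal (k x))).real D -
        (q ∗ (volume.withDensity fun x => ENNReal.ofReal (k x))).real D| ≤ C₁ * κ := by
    intro D hD _
    refine (abs_conv_sub_le (μ + n) q hψLi hk0 hki hψk hD).trans ?_
    simp_rw [hdiff]
    exact hfour L κ H hL hH hHb
  have hδ : 0 < 2 * (a / L) := by positivity
  have := abs_measureReal_sub_le_of_conv (μ + n) q
    (volume.withDensity fun x => ENNReal.ofReal (k x)) hk34 hΔ
    (S := B * (1 + ‖m‖) * (2 * (a / L)))
    (fun D hD => (hshell m _ hδ D hD).1) (fun D hD => (hshell m _ hδ D hD).2) hCm hC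
  have he : (μ + n).real C - q.real C = μ.real C - ∫ y in C, f y := by
    rw [setIntegral_eq_posPart_sub_negPart hfi hCm, measureReal_add_apply]
    ring
  rw [he] at this
  refine this.trans ?_
  have e : 2 * (C₁ * κ) + 3 / 2 * (B * (1 + ‖m‖) * (2 * (a / L)))
      = 2 * C₁ * κ + 3 / 2 * (B * (2 * a)) * ((1 + ‖m‖) / L) := by ring
  rw [e]
  have h1 : 0 ≤ (1 + ‖m‖) / L := by positivity
  have h2 : 0 ≤ 3 / 2 * (B * (2 * a)) * κ := by positivity
  have h3 : 0 ≤ 2 * C₁ * ((1 + ‖m‖) / L) := by positivity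
  nlinarith

end Core

/-! ### Reduction of K to the identity. -/

section Whitening

open scoped MatrixOrder

variable {d : ℕ}

/-- The eigenvalues of A are at most R, so R - A is Hermitian with nonnegative spectrum, hence
positive semidefinite. -/
theorem spectralRadius_quadForm_le {A : Matrix (Fin d) (Fin d) ℝ} (hA : A.PosDef) {R : ℝ}
    (hR : 0 ≤ R) (h : spectralRadius ℝ A ≤ ENNReal.ofReal R) (x : EuclideanSpace ℝ (Fin d)) :
    quadForm A x ≤ R * ‖x‖ ^ 2 := by
  have hle : ∀ k ∈ spectrum ℝ A, k ≤ R := by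
    intro k hk
    have h1 : (‖k‖₊ : ENNReal) ≤ spectralRadius ℝ A :=
      le_iSup₂ (f := fun (k : ℝ) (_ : k ∈ spectrum ℝ A) => (‖k‖₊ : ENNReal)) k hk
    have h2 := h1.trans h
    rw [← ENNReal.ofReal_coe_nnreal, ENNReal.ofReal_le_ofReal_iff hR] at h2
    exact (le_abs_self k).trans h2
  have hpsd : (algebraMap ℝ (Matrix (Fin d) (Fin d) ℝ) R - A).PosSemidef := by
    rw [Matrix.posSemidef_iff_isHermitian_and_spectrum_nonneg]
    refine ⟨?_, fun k hk => ?_⟩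
    · refine Matrix.IsHermitian.sub ?_ hA.isHermitian
      rw [Algebra.algebraMap_eq_smul_one]
      exact Matrix.IsHermitian.ext fun i j => by
        by_cases hij : i = j <;> simp [hij, Ne.symm]
    · have h1 : R - k ∈ spectrum ℝ A := by
        have := spectrum.singleton_sub_eq A R
        rw [← this] at hk
        obtain ⟨a, ha, b, hb, hab⟩ := hk
        rw [Set.mem_singleton_iff] at ha
        simp only at hab
        have : b = R - k := by rw [← hab, ha]; ring
        rwa [← this]
      exact sub_nonneg.1 (by linarith [hle _ h1] : (0 : ℝ) ≤ k - 0) |>.trans (by simp)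
  have := hpsd.dotProduct_mulVec_nonneg (WithLp.ofLp x)
  rw [Algebra.algebraMap_eq_smul_one, Matrix.sub_mulVec, Matrix.smul_mulVec, Matrix.one_mulVec,
    dotProduct_sub, dotProduct_smul] at this
  have hn : ‖x‖ ^ 2 = star (WithLp.ofLp x) ⬝ᵥ WithLp.ofLp x := by
    rw [EuclideanSpace.norm_sq_eq]
    simp [dotProduct, sq]
  rw [hn, quadForm]
  simpa using this

theorem ofLp_toEuclideanLin (M : Matrix (Fin d) (Fin d) ℝ) (v : EuclideanSpace ℝ (Fin d)) :
    WithLp.ofLp (Matrix.toEuclideanLin M v) = M *ᵥ WithLp.ofLp v := rfl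

/-- A linear change of variables which transforms the quadratic form `K⁻¹` into the standard
one. -/
theorem exists_whitening {K : Matrix (Fin d) (Fin d) ℝ} (hK : K.PosDef) :
    ∃ T : EuclideanSpace ℝ (Fin d) ≃L[ℝ] EuclideanSpace ℝ (Fin d),
      |LinearMap.det (T : EuclideanSpace ℝ (Fin d) →ₗ[ℝ] EuclideanSpace ℝ (Fin d))|
        = (Real.sqrt K.det)⁻¹ ∧
      (∀ x v, WithLp.ofLp x ⬝ᵥ (K⁻¹ *ᵥ WithLp.ofLp v) = ⟪T x, T v⟫) ∧
      ∀ ξ, quadForm K (ContinuousLinearMap.adjoint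
        (T : EuclideanSpace ℝ (Fin d) →L[ℝ] EuclideanSpace ℝ (Fin d)) ξ) = ‖ξ‖ ^ 2 := by
  -- Factor K⁻¹ = WᵗW; the map T is W.
  obtain ⟨W, hW⟩ := CStarAlgebra.nonneg_iff_eq_star_mul_self.mp hK.inv.posSemidef.nonneg
  rw [Matrix.star_eq_conjTranspose, Matrix.conjTranspose_eq_transpose_of_trivial] at hW
  have hKdet : 0 < K.det := hK.det_pos
  have hKu : IsUnit K.det := hKdet.ne'.isUnit
  have hdet : W.det ^ 2 = (K.det)⁻¹ := by
    have := congrArg Matrix.det hW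
    rw [Matrix.det_mul, Matrix.det_transpose, Matrix.det_nonsing_inv, Ring.inverse_eq_inv'] at this
    rw [sq, ← this]
  have hW0 : W.det ≠ 0 := by
    intro h
    rw [h] at hdet
    have : (K.det)⁻¹ ≠ 0 := inv_ne_zero hKdet.ne'
    simp at hdet
    exact hKdet.ne' hdet.symm
  have hWu : IsUnit W.det := hW0.isUnit
  have hlin : LinearMap.det (Matrix.toEuclideanLin W) = W.det := by
    have : Matrix.toEuclideanLin W = Matrix.toLin (PiLp.basisFun 2 ℝ (Fin d))
        (PiLp.basisFun 2 ℝ (Fin d)) W := rfl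
    rw [this, LinearMap.det_toLin]
  -- A one-sided inverse of a square matrix is two-sided, so WᵗWK = 1 gives WKWᵗ = 1: the form K at
  -- Wᵗξ is ‖ξ‖².
  have hWKW : W * K * Wᵀ = 1 := by
    have h1 : Wᵀ * W * K = 1 := by rw [← hW]; exact Matrix.nonsing_inv_mul K hKu
    have h2 : Wᵀ * (W * K) = 1 := by rw [← Matrix.mul_assoc]; exact h1
    exact mul_eq_one_comm.1 h2
  let T₀ := (Matrix.toEuclideanLin W).equivOfDetNeZero (by rw [hlin]; exact hW0)
  have hT₀ : ∀ x, T₀ x = Matrix.toEuclideanLin W x := fun x => rfl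
  refine ⟨T₀.toContinuousLinearEquiv, ?_, fun x v => ?_, fun ξ => ?_⟩
  · have : ((T₀.toContinuousLinearEquiv : EuclideanSpace ℝ (Fin d) ≃L[ℝ] EuclideanSpace ℝ (Fin d))
        : EuclideanSpace ℝ (Fin d) →ₗ[ℝ] EuclideanSpace ℝ (Fin d)) = Matrix.toEuclideanLin W := by
      ext x; rfl
    rw [this, hlin, ← Real.sqrt_inv, ← hdet, Real.sqrt_sq_eq_abs]
  · rw [hW]
    change _ = ⟪Matrix.toEuclideanLin W x, Matrix.toEuclideanLin W v⟫
    rw [EuclideanSpace.inner_eq_star_dotProduct, ofLp_toEuclideanLin,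
      ofLp_toEuclideanLin, star_trivial, ← Matrix.mulVec_mulVec,
      Matrix.dotProduct_mulVec, Matrix.vecMul_transpose, dotProduct_comm]
  · have hadj : ContinuousLinearMap.adjoint ((T₀.toContinuousLinearEquiv :
        EuclideanSpace ℝ (Fin d) ≃L[ℝ] EuclideanSpace ℝ (Fin d)) :
        EuclideanSpace ℝ (Fin d) →L[ℝ] EuclideanSpace ℝ (Fin d)) ξ
        = Matrix.toEuclideanLin Wᵀ ξ := by
      refine ext_inner_left ℝ fun v => ?_
      rw [ContinuousLinearMap.adjoint_inner_right]
      change ⟪Matrix.toEuclideanLin W v, ξ⟫ = _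
      rw [EuclideanSpace.inner_eq_star_dotProduct, EuclideanSpace.inner_eq_star_dotProduct,
        ofLp_toEuclideanLin, ofLp_toEuclideanLin, star_trivial,
        star_trivial, Matrix.dotProduct_mulVec, ← Matrix.mulVec_transpose]
    rw [hadj, quadForm, ofLp_toEuclideanLin, Matrix.dotProduct_mulVec,
      Matrix.dotProduct_mulVec, ← Matrix.mulVec_transpose, ← Matrix.mulVec_transpose,
      Matrix.mulVec_mulVec, Matrix.mulVec_mulVec]
    have hKt : Kᵀ = K := by
      have := hK.isHermitian.eq
      rwa [Matrix.conjTranspose_eq_transpose_of_trivial] at this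
    rw [Matrix.transpose_transpose, hKt, hWKW, Matrix.one_mulVec,
      EuclideanSpace.norm_sq_eq]
    simp [dotProduct, sq]

theorem integral_comp_continuousLinearEquiv {V F : Type*} [NormedAddCommGroup V]
    [InnerProductSpace ℝ V] [FiniteDimensional ℝ V] [MeasurableSpace V] [BorelSpace V]
    [NormedAddCommGroup F] [NormedSpace ℝ F] (T : V ≃L[ℝ] V) (g : V → F) :
    ∫ x, g x = |LinearMap.det (T : V →ₗ[ℝ] V)| • ∫ x, g (T x) := by
  have hdet : LinearMap.det (T : V →ₗ[ℝ] V) ≠ 0 := T.toLinearEquiv.isUnit_det'.ne_zero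
  have h1 := Measure.map_linearMap_addHaar_eq_smul_addHaar (volume : Measure V) hdet
  have h2 : ∫ x, g (T x) = ∫ y, g y ∂(Measure.map T volume) :=
    (integral_map_equiv T.toHomeomorph.toMeasurableEquiv g).symm
  have h3 : Measure.map T volume = Measure.map (T : V →ₗ[ℝ] V) volume := rfl
  rw [h2, h3, h1, integral_smul_measure, ENNReal.toReal_ofReal (abs_nonneg _), smul_smul, abs_inv,
    mul_inv_cancel₀ (abs_pos.2 hdet).ne', one_smul]

/-- With gradient i m, the product -i · i = 1 makes the correction real, and xᵗK⁻¹m is ⟪T x, T m⟫.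
-/
theorem modifiedGaussianDensity_eq {K : Matrix (Fin d) (Fin d) ℝ} {t : ℝ}
    {T : EuclideanSpace ℝ (Fin d) ≃L[ℝ] EuclideanSpace ℝ (Fin d)}
    (hT : ∀ x v, WithLp.ofLp x ⬝ᵥ (K⁻¹ *ᵥ WithLp.ofLp v) = ⟪T x, T v⟫)
    (m x : EuclideanSpace ℝ (Fin d)) :
    modifiedGaussianDensity K (fun i => Complex.I * m i) t x
      = (Real.sqrt K.det)⁻¹ * correctedStdDensity ((Real.sqrt t)⁻¹ • T m) (T x) := by
  have h1 : ((fun i => (x i : ℂ)) ⬝ᵥ ((K⁻¹).map (fun r : ℝ => (r : ℂ)) *ᵥ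
      fun i => Complex.I * (m i : ℂ))) = Complex.I * (⟪T x, T m⟫ : ℝ) := by
    rw [← hT]
    simp only [dotProduct, Matrix.mulVec, Matrix.map_apply]
    push_cast
    simp only [Finset.mul_sum]
    refine Finset.sum_congr rfl fun i _ => Finset.sum_congr rfl fun j _ => ?_
    ring
  have h2 : (1 - Complex.I * (Complex.I * (⟪T x, T m⟫ : ℝ)) / (Real.sqrt t : ℂ)).re
      = 1 + ⟪T x, (Real.sqrt t)⁻¹ • T m⟫ := by
    rw [← mul_assoc, Complex.I_mul_I, inner_smul_right]
    have : (1 - -1 * ((⟪T x, T m⟫ : ℝ) : ℂ) / (Real.sqrt t : ℂ))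
        = ((1 + (Real.sqrt t)⁻¹ * ⟪T x, T m⟫ : ℝ) : ℂ) := by push_cast; ring
    rw [this, Complex.ofReal_re]
  rw [modifiedGaussianDensity, h1, h2, correctedStdDensity, quadForm, hT,
    real_inner_self_eq_norm_sq, finrank_euclideanSpace_fin, Real.sqrt_mul (by positivity), mul_inv]
  ring

theorem modifiedGaussian_apply {K : Matrix (Fin d) (Fin d) ℝ} {t : ℝ}
    {T : EuclideanSpace ℝ (Fin d) ≃L[ℝ] EuclideanSpace ℝ (Fin d)}
    (hdet : |LinearMap.det (T : EuclideanSpace ℝ (Fin d) →ₗ[ℝ] EuclideanSpace ℝ (Fin d))|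
        = (Real.sqrt K.det)⁻¹)
    (hT : ∀ x v, WithLp.ofLp x ⬝ᵥ (K⁻¹ *ᵥ WithLp.ofLp v) = ⟪T x, T v⟫)
    (m : EuclideanSpace ℝ (Fin d)) :
    Integrable (modifiedGaussianDensity K (fun i => Complex.I * m i) t) ∧
    ∀ C, MeasurableSet C → modifiedGaussian K (fun i => Complex.I * m i) t C
      = ∫ y in T.symm ⁻¹' C, correctedStdDensity ((Real.sqrt t)⁻¹ • T m) y := by
  have hfun : modifiedGaussianDensity K (fun i => Complex.I * m i) t
      = fun x => (Real.sqrt K.det)⁻¹ * correctedStdDensity ((Real.sqrt t)⁻¹ • T m) (T x) :=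
    funext fun x => modifiedGaussianDensity_eq hT m x
  have hI : Integrable (modifiedGaussianDensity K (fun i => Complex.I * m i) t) := by
    rw [hfun]
    refine Integrable.const_mul ?_ _
    have hdet0 : LinearMap.det
        (T : EuclideanSpace ℝ (Fin d) →ₗ[ℝ] EuclideanSpace ℝ (Fin d)) ≠ 0 :=
      T.toLinearEquiv.isUnit_det'.ne_zero
    have h1 := Measure.map_linearMap_addHaar_eq_smul_addHaar
      (volume : Measure (EuclideanSpace ℝ (Fin d))) hdet0
    have h2 : Integrable (correctedStdDensity ((Real.sqrt t)⁻¹ • T m)) (Measure.map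
        (T : EuclideanSpace ℝ (Fin d) →ₗ[ℝ] EuclideanSpace ℝ (Fin d)) volume) := by
      rw [h1]
      exact (integrable_correctedStdDensity _).smul_measure ENNReal.ofReal_ne_top
    exact (integrable_map_equiv T.toHomeomorph.toMeasurableEquiv _).1 h2
  refine ⟨hI, fun C hC => ?_⟩
  have hC' : MeasurableSet (T.symm ⁻¹' C) := T.symm.continuous.measurable hC
  rw [modifiedGaussian, withDensityᵥ_apply hI hC, ← integral_indicator hC,
    ← integral_indicator hC', integral_comp_continuousLinearEquiv T
      ((T.symm ⁻¹' C).indicator _), hdet, smul_eq_mul, ← integral_const_mul]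
  refine integral_congr_ae (ae_of_all _ fun x => ?_)
  change _ = (Real.sqrt K.det)⁻¹ * _
  by_cases hx : x ∈ C
  · rw [Set.indicator_of_mem hx, Set.indicator_of_mem (by simpa using hx), hfun]
  · rw [Set.indicator_of_notMem hx, Set.indicator_of_notMem (by simpa using hx), mul_zero]

theorem signedFourier_withDensity {f : EuclideanSpace ℝ (Fin d) → ℝ} (hf : Integrable f)
    (hfm : Measurable f) (ζ : EuclideanSpace ℝ (Fin d)) :
    signedFourier (volume.withDensityᵥ f) ζ
      = ∫ y, (f y : ℂ) * Complex.exp ((⟪y, ζ⟫ : ℂ) * Complex.I) := by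
  rw [← charFun_posPart_sub_negPart hf hfm, signedFourier,
    withDensityᵥ_eq_withDensity_pos_part_sub_withDensity_neg_part hf]
  have := isFiniteMeasure_withDensity_ofReal hf.2
  have := isFiniteMeasure_withDensity_ofReal hf.neg.2
  have hb : ∀ ν : Measure (EuclideanSpace ℝ (Fin d)), ∀ _ : IsFiniteMeasure ν,
      VectorMeasure.Integrable ν.toSignedMeasure
        (fun x => Complex.exp (((⟪ζ, x⟫ : ℝ) : ℂ) * Complex.I)) := by
    intro ν _
    rw [VectorMeasure.Integrable, Measure.variation_toSignedMeasure]
    refine Integrable.of_bound (C := 1) (Continuous.aestronglyMeasurable (by fun_prop))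
      (ae_of_all _ fun y => ?_)
    rw [Complex.norm_exp_ofReal_mul_I]
  rw [VectorMeasure.integral_sub_vectorMeasure (hb _ _) (hb _ _),
    VectorMeasure.integral_toSignedMeasure, VectorMeasure.integral_toSignedMeasure]
  simp only [charFun_apply, real_inner_comm]

theorem signedFourier_modifiedGaussian {K : Matrix (Fin d) (Fin d) ℝ} (hK : K.PosDef)
    (m ζ : EuclideanSpace ℝ (Fin d)) (t : ℝ) :
    signedFourier (modifiedGaussian K (fun i => Complex.I * m i) t) ζ =
        Complex.exp ((-(quadForm K ζ) / 2 : ℝ) : ℂ) *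
          (1 + (∑ i, (ζ i : ℂ) * (Complex.I * m i)) / (Real.sqrt t : ℂ)) := by
  obtain ⟨T, hdet, hT, hTK⟩ := exists_whitening hK
  obtain ⟨hI, -⟩ := modifiedGaussian_apply (t := t) hdet hT m
  have hfun : modifiedGaussianDensity K (fun i => Complex.I * m i) t
      = fun x => (Real.sqrt K.det)⁻¹ * correctedStdDensity ((Real.sqrt t)⁻¹ • T m) (T x) :=
    funext fun x => modifiedGaussianDensity_eq hT m x
  have hmeas : Measurable (modifiedGaussianDensity K (fun i => Complex.I * m i) t) := by
    rw [hfun]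
    unfold correctedStdDensity
    exact Continuous.measurable (by fun_prop)
  -- This frequency satisfies ⟪T x, ξ⟫ = ⟪x, ζ⟫ and T*ξ = ζ, so ‖ξ‖² is the form K at ζ.
  set ξ := ContinuousLinearMap.adjoint
    (T.symm : EuclideanSpace ℝ (Fin d) →L[ℝ] EuclideanSpace ℝ (Fin d)) ζ with hξ
  have hTξ : ContinuousLinearMap.adjoint
      (T : EuclideanSpace ℝ (Fin d) →L[ℝ] EuclideanSpace ℝ (Fin d)) ξ = ζ := by
    refine ext_inner_left ℝ fun v => ?_
    rw [ContinuousLinearMap.adjoint_inner_right, hξ, ContinuousLinearMap.adjoint_inner_right]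
    simp
  have hinner : ∀ v, ⟪ξ, T v⟫ = ⟪ζ, v⟫ := fun v => by
    rw [hξ, ContinuousLinearMap.adjoint_inner_left]
    simp
  rw [modifiedGaussian, signedFourier_withDensity hI hmeas, hfun]
  have h1 := integral_cexp_correctedStdDensity ((Real.sqrt t)⁻¹ • T m) ξ
  rw [integral_comp_continuousLinearEquiv T, hdet, ← integral_smul] at h1
  have h2 : ∀ x : EuclideanSpace ℝ (Fin d), ⟪T x, ξ⟫ = ⟪x, ζ⟫ := fun x => by
    rw [real_inner_comm, hinner, real_inner_comm]
  simp only [h2, Complex.real_smul] at h1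
  have h3 : ∑ i, (ζ i : ℂ) * (Complex.I * m i) = Complex.I * (⟪ζ, m⟫ : ℝ) := by
    rw [PiLp.inner_apply]
    push_cast
    rw [Finset.mul_sum]
    refine Finset.sum_congr rfl fun i _ => ?_
    simp
    ring
  rw [h3, ← hTξ, hTK, hTξ]
  rw [inner_smul_right, hinner] at h1
  calc _ = ∫ x, (((Real.sqrt K.det)⁻¹ : ℝ) : ℂ) *
        ((correctedStdDensity ((Real.sqrt t)⁻¹ • T m) (T x) : ℂ) *
          Complex.exp ((⟪x, ζ⟫ : ℂ) * Complex.I)) := by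
        refine integral_congr_ae (ae_of_all _ fun x => ?_)
        push_cast; ring
    _ = _ := by rw [h1]; push_cast; ring_nf

end Whitening

/-! ### Taylor estimates at the origin and operator norms. -/

/-- The mean value inequality, for the derivative on the ball of radius B, then for f on the ball of
radius ‖u‖. -/
theorem norm_le_of_norm_iteratedFDeriv_two_le {V F : Type*} [NormedAddCommGroup V] [NormedSpace ℝ V]
    [NormedAddCommGroup F] [NormedSpace ℝ F] {f : V → F} {r M B : ℝ} (hf : ContDiff ℝ 2 f)
    (h0 : f 0 = 0) (h1 : ‖fderiv ℝ f 0‖ ≤ r) (hM : 0 ≤ M)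
    (h2 : ∀ u, ‖u‖ ≤ B → ‖iteratedFDeriv ℝ 2 f u‖ ≤ M) {u : V} (hu : ‖u‖ ≤ B) :
    ‖fderiv ℝ f u‖ ≤ r + M * ‖u‖ ∧ ‖f u‖ ≤ r * ‖u‖ + M * ‖u‖ ^ 2 := by
  have hB : 0 ≤ B := (norm_nonneg u).trans hu
  have hdf : Differentiable ℝ (fderiv ℝ f) :=
    (hf.fderiv_right (m := 1) (by norm_num)).differentiable (by norm_num)
  have key : ∀ v : V, ‖v‖ ≤ B → ‖fderiv ℝ f v‖ ≤ r + M * ‖v‖ := by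
    intro v hv
    have := (convex_closedBall (0 : V) B).norm_image_sub_le_of_norm_fderiv_le (𝕜 := ℝ)
      (f := fderiv ℝ f) (C := M) (fun x _ => hdf x) (fun x hx => ?_)
      (Metric.mem_closedBall_self hB) (mem_closedBall_zero_iff.2 hv)
    · rw [sub_zero] at this
      calc ‖fderiv ℝ f v‖ = ‖fderiv ℝ f 0 + (fderiv ℝ f v - fderiv ℝ f 0)‖ := by
            rw [add_sub_cancel]
        _ ≤ _ := (norm_add_le _ _).trans (add_le_add h1 this)
    · have h := h2 x (mem_closedBall_zero_iff.1 hx)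
      rw [← norm_iteratedFDeriv_fderiv (n := 1), norm_iteratedFDeriv_one] at h
      exact h
  refine ⟨key u hu, ?_⟩
  have := (convex_closedBall (0 : V) ‖u‖).norm_image_sub_le_of_norm_fderiv_le (𝕜 := ℝ)
      (f := f) (C := r + M * ‖u‖) (fun x _ => (hf.differentiable (by norm_num)) x)
      (fun x hx => ?_)
      (Metric.mem_closedBall_self (norm_nonneg u)) (mem_closedBall_zero_iff.2 le_rfl)
  · rw [sub_zero, h0, sub_zero] at this
    calc _ ≤ _ := this
      _ = _ := by ring
  · have hx' := mem_closedBall_zero_iff.1 hx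
    exact (key x (hx'.trans hu)).trans (by gcongr)

/-- A derivative of order k gains s^k, which suffices for k ≥ 2. Orders 0 and 1 recover the missing
powers of s from f 0 = 0 and the small gradient, at the price of the factor (1+‖ζ‖)². -/
theorem norm_iteratedFDeriv_comp_clm_le_of_taylor {V W F : Type*} [NormedAddCommGroup V] [NormedSpace ℝ V]
    [NormedAddCommGroup W] [NormedSpace ℝ W]
    [NormedAddCommGroup F] [NormedSpace ℝ F] {f : V → F} {n : ℕ} {r M B s : ℝ}
    (hf : ContDiff ℝ (n : WithTop ℕ∞) f) (hn : 2 ≤ n) (h0 : f 0 = 0) (h1 : ‖fderiv ℝ f 0‖ ≤ r)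
    (hr : 0 ≤ r) (hM : 0 ≤ M)
    (h2 : ∀ k, 2 ≤ k → k ≤ n → ∀ u, ‖u‖ ≤ B → ‖iteratedFDeriv ℝ k f u‖ ≤ M)
    (hs0 : 0 ≤ s) (hs1 : s ≤ 1) {S : W →L[ℝ] V} (hS : ‖S‖ ≤ s) {ζ : W} (hu : ‖S ζ‖ ≤ B)
    {k : ℕ} (hk : k ≤ n) :
    ‖iteratedFDeriv ℝ k (f ∘ S) ζ‖ ≤ (r * s + M * s ^ 2) * (1 + ‖ζ‖) ^ 2 := by
  obtain ⟨hu1, hu0⟩ := norm_le_of_norm_iteratedFDeriv_two_le (hf.of_le (by exact_mod_cast hn))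
    h0 h1 hM (h2 2 le_rfl hn) hu
  have hSx : ‖S ζ‖ ≤ s * ‖ζ‖ := (S.le_opNorm ζ).trans (by gcongr)
  have hcomp : ‖iteratedFDeriv ℝ k (f ∘ S) ζ‖ ≤ ‖iteratedFDeriv ℝ k f (S ζ)‖ * s ^ k := by
    rw [S.iteratedFDeriv_comp_right hf ζ (by exact_mod_cast hk)]
    refine (ContinuousMultilinearMap.norm_compContinuousLinearMap_le _ _).trans ?_
    gcongr
    rw [Finset.prod_const, Finset.card_univ, Fintype.card_fin]
    gcongr
  refine hcomp.trans ?_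
  have hz := norm_nonneg ζ
  have ha : 0 ≤ r * s := mul_nonneg hr hs0
  have hb : 0 ≤ M * s ^ 2 := by positivity
  have hz0 : 1 ≤ (1 + ‖ζ‖) ^ 2 := by nlinarith
  have hz1 : ‖ζ‖ ≤ (1 + ‖ζ‖) ^ 2 := by nlinarith
  have hz2 : ‖ζ‖ ^ 2 ≤ (1 + ‖ζ‖) ^ 2 := by nlinarith
  rw [add_mul]
  match k, hk with
  | 0, _ =>
    rw [norm_iteratedFDeriv_zero, pow_zero, mul_one]
    calc ‖f (S ζ)‖ ≤ r * (s * ‖ζ‖) + M * (s * ‖ζ‖) ^ 2 := by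
          refine hu0.trans ?_
          gcongr
      _ = (r * s) * ‖ζ‖ + (M * s ^ 2) * ‖ζ‖ ^ 2 := by ring
      _ ≤ _ := by gcongr
  | 1, _ =>
    rw [norm_iteratedFDeriv_one, pow_one]
    calc ‖fderiv ℝ f (S ζ)‖ * s ≤ (r + M * (s * ‖ζ‖)) * s := by
          refine mul_le_mul_of_nonneg_right (hu1.trans ?_) hs0
          gcongr
      _ = (r * s) * 1 + (M * s ^ 2) * ‖ζ‖ := by ring
      _ ≤ _ := by gcongr
  | k + 2, hk =>
    have hp : s ^ (k + 2) ≤ s ^ 2 := pow_le_pow_of_le_one hs0 hs1 (Nat.le_add_left 2 k)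
    calc ‖iteratedFDeriv ℝ (k + 2) f (S ζ)‖ * s ^ (k + 2) ≤ M * s ^ 2 :=
          mul_le_mul (h2 _ (by omega) hk _ hu) hp (by positivity) hM
      _ = 0 + (M * s ^ 2) * 1 := by ring
      _ ≤ _ := by gcongr; positivity

/-- Expanding each argument in the standard basis gives d^k terms. This passes from partial
derivatives to operator norms. -/
theorem norm_le_of_norm_apply_single_le {d k : ℕ} {F : Type*} [NormedAddCommGroup F]
    [NormedSpace ℝ F]
    (f : ContinuousMultilinearMap ℝ (fun _ : Fin k => EuclideanSpace ℝ (Fin d)) F) {M : ℝ}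
    (hM : 0 ≤ M)
    (h : ∀ α : Fin k → Fin d, ‖f fun j => EuclideanSpace.single (α j) (1 : ℝ)‖ ≤ M) :
    ‖f‖ ≤ (d : ℝ) ^ k * M := by
  refine f.opNorm_le_bound (by positivity) fun x => ?_
  have hx : x = fun j => ∑ i, (x j i) • EuclideanSpace.single i (1 : ℝ) := by
    funext j
    ext i
    simp [Pi.single_apply]
  conv_lhs => rw [hx]
  rw [f.map_sum]
  calc ‖∑ α : Fin k → Fin d, f fun j => (x j (α j)) • EuclideanSpace.single (α j) (1 : ℝ)‖
      ≤ ∑ _α : Fin k → Fin d, M * ∏ j, ‖x j‖ := by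
        refine norm_sum_le_of_le _ fun α _ => ?_
        rw [f.map_smul_univ, norm_smul, mul_comm, norm_prod]
        gcongr with j
        · exact h α
        · exact PiLp.norm_apply_le (x j) (α j)
    _ = _ := by simp; ring

/-! ### Back to the original coordinates. -/

section Transfer

variable {d : ℕ}

theorem residue_zero (μ : Measure (EuclideanSpace ℝ (Fin d))) [IsProbabilityMeasure μ]
    (K : Matrix (Fin d) (Fin d) ℝ) (t : ℝ) : residue μ K t 0 = 1 := by
  simp [residue, quadForm]

theorem charFun_eq_residue (μ : Measure (EuclideanSpace ℝ (Fin d)))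
    (K : Matrix (Fin d) (Fin d) ℝ) (t : ℝ) (ζ : EuclideanSpace ℝ (Fin d)) :
    charFun μ ζ = Complex.exp ((-(t * quadForm K ζ / 2) : ℝ) : ℂ) * residue μ K t ζ := by
  rw [residue, mul_left_comm, ← Complex.exp_add, ← Complex.ofReal_add, neg_add_cancel]
  simp

theorem quadForm_smul (K : Matrix (Fin d) (Fin d) ℝ) (c : ℝ) (x : EuclideanSpace ℝ (Fin d)) :
    quadForm K (c • x) = c ^ 2 * quadForm K x := by
  simp only [quadForm, WithLp.ofLp_smul, Matrix.mulVec_smul, smul_dotProduct, dotProduct_smul,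
    smul_eq_mul]
  ring

/-- The residue without its first order Taylor polynomial, when the gradient at the origin is
`i m`. -/
noncomputable def residueRemainder (μ : Measure (EuclideanSpace ℝ (Fin d))) (K : Matrix (Fin d) (Fin d) ℝ)
    (t : ℝ) (m u : EuclideanSpace ℝ (Fin d)) : ℂ :=
  residue μ K t u - 1 - Complex.I * (⟪u, m⟫ : ℝ)

/-- Apply `exists_abs_sub_correctedStd_le` to the law of T X/√t, with H the remainder composed with
S and L = B/s: as ‖S‖ ≤ s, the map S sends the ball of radius L into that of radius B. The condition
s ≤ B gives L ≥ 1. -/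
theorem exists_abs_sub_modifiedGaussian_le (hd : 0 < d) : ∃ C₀ : ℝ, 0 ≤ C₀ ∧
    ∀ (μ : Measure (EuclideanSpace ℝ (Fin d))) (K : Matrix (Fin d) (Fin d) ℝ) (t R s r M B : ℝ)
      (m : EuclideanSpace ℝ (Fin d)), IsProbabilityMeasure μ → K.PosDef → 0 < t → 0 < R →
      (∀ x, quadForm K⁻¹ x ≤ R * ‖x‖ ^ 2) → s = 2 * Real.pi * Real.sqrt R / Real.sqrt t →
      s ≤ 1 → s ≤ B → 0 ≤ r → 0 ≤ M →
      ContDiff ℝ ((d + 1 : ℕ) : WithTop ℕ∞) (residueRemainder μ K t m) →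
      ‖fderiv ℝ (residueRemainder μ K t m) 0‖ ≤ r →
      (∀ k, 2 ≤ k → k ≤ d + 1 → ∀ u, ‖u‖ ≤ B →
        ‖iteratedFDeriv ℝ k (residueRemainder μ K t m) u‖ ≤ M) →
      ∀ C, MeasurableSet C → Convex ℝ C →
        |(μ.map fun x => (Real.sqrt t)⁻¹ • x).real C
          - modifiedGaussian K (fun i => Complex.I * m i) t C|
          ≤ C₀ * (r * s + M * s ^ 2 + (1 + s * ‖m‖) * (s / B)) := by
  have : Nontrivial (EuclideanSpace ℝ (Fin d)) :=
    Module.nontrivial_of_finrank_pos (R := ℝ) (by simpa using hd)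
  obtain ⟨C₀, hC₀, H⟩ := exists_abs_sub_correctedStd_le (EuclideanSpace ℝ (Fin d))
  refine ⟨C₀, hC₀, ?_⟩
  intro μ K t R s r M B m hμ hK ht hR hKR hs hs1 hsB hr hM hΘ hΘ1 hΘk C hC hCc
  obtain ⟨T, hdet, hT, hTK⟩ := exists_whitening hK
  obtain ⟨-, hmod⟩ := modifiedGaussian_apply (t := t) hdet hT m
  rw [hmod C hC]
  have hst : 0 < Real.sqrt t := Real.sqrt_pos.2 ht
  have hs0 : 0 < s := by rw [hs]; have := Real.sqrt_pos.2 hR; positivity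
  have hB : 0 < B := hs0.trans_le hsB
  set Tc : EuclideanSpace ℝ (Fin d) →L[ℝ] EuclideanSpace ℝ (Fin d) :=
    (T : EuclideanSpace ℝ (Fin d) →L[ℝ] EuclideanSpace ℝ (Fin d)) with hTc
  have hTn : ‖Tc‖ ≤ Real.sqrt R := by
    refine Tc.opNorm_le_bound (Real.sqrt_nonneg _) fun x => ?_
    have h1 : ‖T x‖ ^ 2 ≤ R * ‖x‖ ^ 2 := by
      rw [← real_inner_self_eq_norm_sq, ← hT]
      exact hKR x
    have h2 := Real.sqrt_le_sqrt h1
    rw [Real.sqrt_sq (norm_nonneg _), Real.sqrt_mul hR.le, Real.sqrt_sq (norm_nonneg _)] at h2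
    exact h2
  set c : ℝ := 2 * Real.pi / Real.sqrt t with hc
  have hc0 : 0 < c := by positivity
  set S : EuclideanSpace ℝ (Fin d) →L[ℝ] EuclideanSpace ℝ (Fin d) :=
    c • ContinuousLinearMap.adjoint Tc with hS
  have hSn : ‖S‖ ≤ s := by
    rw [hS, norm_smul, LinearIsometryEquiv.norm_map, Real.norm_of_nonneg hc0.le, hs, hc]
    calc 2 * Real.pi / Real.sqrt t * ‖Tc‖ ≤ 2 * Real.pi / Real.sqrt t * Real.sqrt R := by gcongr
      _ = _ := by ring
  have hSx : ∀ x, ‖S x‖ ≤ s * ‖x‖ := fun x => (S.le_opNorm x).trans (by gcongr)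
  set m' : EuclideanSpace ℝ (Fin d) := (Real.sqrt t)⁻¹ • T m with hm'
  have hm'n : ‖m'‖ ≤ s * ‖m‖ := by
    rw [hm', norm_smul, norm_inv, Real.norm_of_nonneg hst.le]
    have h1 : ‖T m‖ ≤ Real.sqrt R * ‖m‖ :=
      (Tc.le_opNorm m).trans (by gcongr)
    have h3 : 1 ≤ 2 * Real.pi := by linarith [Real.pi_gt_three]
    calc (Real.sqrt t)⁻¹ * ‖T m‖ ≤ (Real.sqrt t)⁻¹ * (Real.sqrt R * ‖m‖) := by gcongr
      _ = 1 * (Real.sqrt R / Real.sqrt t * ‖m‖) := by ring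
      _ ≤ (2 * Real.pi) * (Real.sqrt R / Real.sqrt t * ‖m‖) := by gcongr
      _ = s * ‖m‖ := by rw [hs]; ring
  set f := residueRemainder μ K t m with hf
  have hf0 : f 0 = 0 := by simp [hf, residueRemainder, residue_zero]
  set A : EuclideanSpace ℝ (Fin d) →L[ℝ] EuclideanSpace ℝ (Fin d) := (Real.sqrt t)⁻¹ • Tc with hA
  have hAm : Measurable A := A.continuous.measurable
  have hcf : ∀ ζ, charFun (μ.map A) ((2 * Real.pi) • ζ) = charFun μ (S ζ) := by
    intro ζ
    rw [charFun_apply, charFun_apply, integral_map hAm.aemeasurable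
      (Continuous.aestronglyMeasurable (by fun_prop))]
    refine integral_congr_ae (ae_of_all _ fun x => ?_)
    have : ⟪A x, (2 * Real.pi) • ζ⟫ = ⟪x, S ζ⟫ := by
      rw [hA, hS, hc]
      simp only [smul_apply, inner_smul_left, inner_smul_right,
        ContinuousLinearMap.adjoint_inner_right]
      simp
      ring
    simp only [this]
  have hmain := H (μ.map A) m' (f ∘ S) (B / s) (r * s + M * s ^ 2)
    (Measure.isProbabilityMeasure_map hAm.aemeasurable) ((one_le_div hs0).2 hsB) ?_ ?_ ?_
    (T.symm ⁻¹' C) (T.symm.continuous.measurable hC)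
    (hCc.linear_preimage (T.symm : EuclideanSpace ℝ (Fin d) →ₗ[ℝ] EuclideanSpace ℝ (Fin d)))
  · have hset : (μ.map fun x => (Real.sqrt t)⁻¹ • x).real C
        = (μ.map A).real (T.symm ⁻¹' C) := by
      rw [map_measureReal_apply (by fun_prop) hC,
        map_measureReal_apply hAm (T.symm.continuous.measurable hC)]
      congr 1
      ext x
      simp [hA, hTc]
    rw [hset]
    refine hmain.trans ?_
    gcongr
    rw [div_div_eq_mul_div, mul_div_assoc]
    gcongr
  · rw [finrank_euclideanSpace_fin]
    exact hΘ.comp S.contDiff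
  · intro k hk ζ hζ
    rw [finrank_euclideanSpace_fin] at hk
    have hu : ‖S ζ‖ ≤ B := by
      calc ‖S ζ‖ ≤ s * ‖ζ‖ := hSx ζ
        _ ≤ s * (B / s) := by gcongr
        _ = B := by field_simp
    exact norm_iteratedFDeriv_comp_clm_le_of_taylor hΘ (by omega) hf0 hΘ1 hr hM hΘk hs0.le hs1 hSn hu hk
  · intro ζ
    rw [hcf, charFun_eq_residue μ K t]
    have hq : t * quadForm K (S ζ) / 2 = 2 * Real.pi ^ 2 * ‖ζ‖ ^ 2 := by
      rw [hS, smul_apply, quadForm_smul, hTK, hc, div_pow,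
        Real.sq_sqrt ht.le]
      field_simp
    have hinn : ⟪S ζ, m⟫ = ⟪(2 * Real.pi) • ζ, m'⟫ := by
      rw [hS, hm', hc, smul_apply, inner_smul_left, inner_smul_left,
        inner_smul_right, ContinuousLinearMap.adjoint_inner_left]
      simp [hTc]
      ring
    rw [hq]
    congr 1
    rw [← hinn, Function.comp_apply, hf, residueRemainder]
    ring

end Transfer

/-! ### The gradient at the origin is purely imaginary. -/

section Gradient

variable {d : ℕ}

theorem partialDeriv_one (i : Fin 1 → Fin d) (f : EuclideanSpace ℝ (Fin d) → ℂ) :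
    partialDeriv i f 0 = gradAtZero f (i 0) := by
  rw [partialDeriv, iteratedFDeriv_one_apply, gradAtZero]

theorem residue_neg (μ : Measure (EuclideanSpace ℝ (Fin d))) (K : Matrix (Fin d) (Fin d) ℝ)
    (t : ℝ) (ζ : EuclideanSpace ℝ (Fin d)) :
    residue μ K t (-ζ) = (starRingEnd ℂ) (residue μ K t ζ) := by
  have hq : quadForm K (-ζ) = quadForm K ζ := by
    have := quadForm_smul K (-1) ζ
    simpa using this
  rw [residue, residue, charFun_neg, hq, map_mul, ← Complex.exp_conj, Complex.conj_ofReal]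

/-- Differentiating θ(-ζ) = conj θ(ζ) at 0 shows that each partial derivative is minus its own
conjugate. -/
theorem re_gradAtZero_residue (μ : Measure (EuclideanSpace ℝ (Fin d)))
    (K : Matrix (Fin d) (Fin d) ℝ) (t : ℝ) (h : DifferentiableAt ℝ (residue μ K t) 0) (i : Fin d) :
    (gradAtZero (residue μ K t) i).re = 0 := by
  have h1 : HasFDerivAt (residue μ K t) (fderiv ℝ (residue μ K t) 0) (-0) := by
    rw [neg_zero]; exact h.hasFDerivAt
  have h2 := HasFDerivAt.comp (f := Neg.neg) (0 : EuclideanSpace ℝ (Fin d)) h1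
    (hasFDerivAt_id (0 : EuclideanSpace ℝ (Fin d))).neg
  have h3 := Complex.conjCLE.hasFDerivAt.comp (0 : EuclideanSpace ℝ (Fin d)) h.hasFDerivAt
  have h4 : residue μ K t ∘ Neg.neg = Complex.conjCLE ∘ residue μ K t :=
    funext fun ζ => residue_neg μ K t ζ
  have h6 := (h4 ▸ h2).unique h3
  have h7 := congrArg Complex.re (DFunLike.congr_fun h6 (EuclideanSpace.single i (1 : ℝ)))
  simp at h7
  rw [gradAtZero]
  linarith

theorem StrongFourierModGaussian.tendsto_gradAtZero
    {μ : ℕ → Measure (EuclideanSpace ℝ (Fin d))} {K : Matrix (Fin d) (Fin d) ℝ} {t : ℕ → ℝ}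
    {θ : EuclideanSpace ℝ (Fin d) → ℂ} (h : StrongFourierModGaussian μ K t θ) :
    Tendsto (fun n => gradAtZero (residue (μ n) K (t n))) atTop (𝓝 (gradAtZero θ)) := by
  refine tendsto_pi_nhds.2 fun i => ?_
  have h1 := (h.tendsto_partialDeriv 1 (by omega) fun _ => i).tendstoLocallyUniformlyOn
    (s := Set.univ) |>.tendsto_at (Set.mem_univ 0)
  simpa only [partialDeriv_one] using h1

/-- The imaginary part of the gradient at the origin. -/
noncomputable def imGradAtZero (f : EuclideanSpace ℝ (Fin d) → ℂ) : EuclideanSpace ℝ (Fin d) :=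
  WithLp.toLp 2 fun i => (gradAtZero f i).im

theorem StrongFourierModGaussian.gradAtZero_eq
    {μ : ℕ → Measure (EuclideanSpace ℝ (Fin d))} {K : Matrix (Fin d) (Fin d) ℝ} {t : ℕ → ℝ}
    {θ : EuclideanSpace ℝ (Fin d) → ℂ} (h : StrongFourierModGaussian μ K t θ) :
    gradAtZero θ = fun i => Complex.I * imGradAtZero θ i := by
  funext i
  have h1 := (Complex.continuous_re.tendsto _).comp (tendsto_pi_nhds.1 h.tendsto_gradAtZero i)
  have h2 : (gradAtZero θ i).re = 0 := by
    refine tendsto_nhds_unique h1 (tendsto_const_nhds.congr fun n => ?_)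
    exact (re_gradAtZero_residue _ _ _
      ((h.contDiff_residue n).differentiable (by simp) 0) i).symm
  apply Complex.ext <;> simp [h2, imGradAtZero]

theorem norm_le_card_mul {x : EuclideanSpace ℝ (Fin d)} {D : ℝ} (h : ∀ i, |x i| ≤ D) :
    ‖x‖ ≤ d * D := by
  have hx : x = ∑ i, (x i) • EuclideanSpace.single i (1 : ℝ) := by
    ext i
    simp [Pi.single_apply]
  rw [hx]
  refine (norm_sum_le _ _).trans ?_
  calc _ ≤ ∑ _i : Fin d, D := Finset.sum_le_sum fun i _ => by simpa [norm_smul] using h i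
    _ = _ := by simp

end Gradient

/-! ### Derivatives of the Taylor remainder. -/

section Remainder

variable {d : ℕ}

theorem residueRemainder_eq (μ : Measure (EuclideanSpace ℝ (Fin d)))
    (K : Matrix (Fin d) (Fin d) ℝ) (t : ℝ) (m : EuclideanSpace ℝ (Fin d)) :
    ∃ l : EuclideanSpace ℝ (Fin d) →L[ℝ] ℂ, (∀ v, l v = -(Complex.I * (⟪v, m⟫ : ℝ))) ∧
      residueRemainder μ K t m = fun u => (residue μ K t u + (-1)) + l u := by
  refine ⟨-(Complex.I • (Complex.ofRealCLM ∘L innerSL ℝ m)), fun v => ?_, ?_⟩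
  · simp [real_inner_comm]
  · funext u
    simp [residueRemainder, real_inner_comm]
    ring

theorem contDiff_residueRemainder {μ : Measure (EuclideanSpace ℝ (Fin d))}
    {K : Matrix (Fin d) (Fin d) ℝ} {t : ℝ} (m : EuclideanSpace ℝ (Fin d)) {n : WithTop ℕ∞}
    (h : ContDiff ℝ n (residue μ K t)) : ContDiff ℝ n (residueRemainder μ K t m) := by
  obtain ⟨l, -, hl⟩ := residueRemainder_eq μ K t m
  rw [hl]
  exact (h.add contDiff_const).add l.contDiff

theorem gradAtZero_residueRemainder {μ : Measure (EuclideanSpace ℝ (Fin d))}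
    {K : Matrix (Fin d) (Fin d) ℝ} {t : ℝ} (m : EuclideanSpace ℝ (Fin d))
    (h : DifferentiableAt ℝ (residue μ K t) 0) :
    gradAtZero (residueRemainder μ K t m)
      = gradAtZero (residue μ K t) - fun i => Complex.I * m i := by
  obtain ⟨l, hlv, hl⟩ := residueRemainder_eq μ K t m
  funext i
  have h1 := (h.hasFDerivAt.add_const (-1 : ℂ)).add l.hasFDerivAt
  have h2 : fderiv ℝ (residueRemainder μ K t m) 0 = fderiv ℝ (residue μ K t) 0 + l := by
    rw [hl]; exact h1.fderiv
  rw [gradAtZero, h2, Pi.sub_apply, add_apply, hlv, gradAtZero, EuclideanSpace.inner_single_left]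
  simp [sub_eq_add_neg]

/-- What is subtracted is affine, so bounds on the residues from order 2 on carry over unchanged. -/
theorem iteratedFDeriv_residueRemainder {μ : Measure (EuclideanSpace ℝ (Fin d))}
    {K : Matrix (Fin d) (Fin d) ℝ} {t : ℝ} (m : EuclideanSpace ℝ (Fin d)) {k : ℕ}
    (h : ContDiff ℝ k (residue μ K t)) (hk : 2 ≤ k) (u : EuclideanSpace ℝ (Fin d)) :
    iteratedFDeriv ℝ k (residueRemainder μ K t m) u = iteratedFDeriv ℝ k (residue μ K t) u := by
  obtain ⟨l, -, hl⟩ := residueRemainder_eq μ K t m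
  obtain ⟨k, rfl⟩ := Nat.exists_eq_add_of_le' hk
  have h1 : iteratedFDeriv ℝ (k + 2) (fun u => (residue μ K t u + (-1)) + l u) u
      = iteratedFDeriv ℝ (k + 2) (fun u => (residue μ K t u + (-1))) u
        + iteratedFDeriv ℝ (k + 2) l u :=
    iteratedFDeriv_add_apply (h.add contDiff_const).contDiffAt l.contDiff.contDiffAt
  have h2 : iteratedFDeriv ℝ (k + 2) (fun u => (residue μ K t u + (-1))) u
      = iteratedFDeriv ℝ (k + 2) (residue μ K t) u
        + iteratedFDeriv ℝ (k + 2) (fun _ => (-1 : ℂ)) u :=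
    iteratedFDeriv_add_apply h.contDiffAt contDiffAt_const
  rw [hl, h1, h2, l.iteratedFDeriv_add_two, iteratedFDeriv_const_of_ne (by omega)]
  simp

end Remainder

/-! ### The convex distance, uniformly in the data. -/

section Distance

variable {d : ℕ}

theorem convexDist_le {μ : Measure (EuclideanSpace ℝ (Fin d))}
    {ν : SignedMeasure (EuclideanSpace ℝ (Fin d))} {b : ℝ}
    (h : ∀ C, MeasurableSet C → Convex ℝ C → |μ.real C - ν C| ≤ b) : convexDist μ ν ≤ b := by
  have : Nonempty {C : Set (EuclideanSpace ℝ (Fin d)) // MeasurableSet C ∧ Convex ℝ C} :=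
    ⟨⟨∅, MeasurableSet.empty, convex_empty⟩⟩
  exact ciSup_le fun C => h C.1 C.2.1 C.2.2

theorem convexDist_nonneg (μ : Measure (EuclideanSpace ℝ (Fin d)))
    (ν : SignedMeasure (EuclideanSpace ℝ (Fin d))) : 0 ≤ convexDist μ ν :=
  Real.iSup_nonneg fun _ => abs_nonneg _

theorem modifiedGaussian_univ {K : Matrix (Fin d) (Fin d) ℝ} (hK : K.PosDef)
    (m : EuclideanSpace ℝ (Fin d)) (t : ℝ) :
    modifiedGaussian K (fun i => Complex.I * m i) t Set.univ = 1 := by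
  obtain ⟨T, hdet, hT, -⟩ := exists_whitening hK
  rw [(modifiedGaussian_apply hdet hT m).2 _ MeasurableSet.univ, Set.preimage_univ,
    setIntegral_univ]
  have h := integral_cexp_correctedStdDensity ((Real.sqrt t)⁻¹ • T m) 0
  simp only [inner_zero_right, inner_zero_left, norm_zero, Complex.ofReal_zero, zero_mul,
    Complex.exp_zero, mul_one] at h
  rw [integral_complex_ofReal] at h
  have h' := congrArg Complex.re h
  simpa using h'

/-- A one-point space has only the empty and the full set. It is treated apart because the shell
estimates need a nontrivial space and the Taylor estimate needs d + 1 ≥ 2. -/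
theorem convexDist_modifiedGaussian_of_dim_zero (hd : d = 0)
    (μ : Measure (EuclideanSpace ℝ (Fin d))) [IsProbabilityMeasure μ]
    {K : Matrix (Fin d) (Fin d) ℝ} (hK : K.PosDef) (m : EuclideanSpace ℝ (Fin d)) (t : ℝ) :
    convexDist μ (modifiedGaussian K (fun i => Complex.I * m i) t) = 0 := by
  subst hd
  refine le_antisymm (convexDist_le fun C _ _ => ?_) (convexDist_nonneg _ _)
  rcases Set.eq_empty_or_nonempty C with rfl | ⟨x, hx⟩
  · simp
  · have : C = Set.univ := Set.eq_univ_of_forall fun y => Subsingleton.elim x y ▸ hx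
    rw [this, modifiedGaussian_univ hK]
    simp

/-- The previous estimate with s = c/√t, multiplied by √t. The powers of d come from passing from
coordinates to operator norms. -/
theorem exists_sqrt_mul_convexDist_le (hd : 0 < d) : ∃ C₀ : ℝ, 0 ≤ C₀ ∧
    ∀ (μ : Measure (EuclideanSpace ℝ (Fin d))) (K : Matrix (Fin d) (Fin d) ℝ) (t R c r M B D : ℝ)
      (m : EuclideanSpace ℝ (Fin d)), IsProbabilityMeasure μ → K.PosDef → 0 < t → 0 < R →
      (∀ x, quadForm K⁻¹ x ≤ R * ‖x‖ ^ 2) → c = 2 * Real.pi * Real.sqrt R →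
      c ≤ Real.sqrt t → 1 ≤ B → 0 ≤ r → 0 ≤ M → ‖m‖ ≤ D →
      ContDiff ℝ ((d + 1 : ℕ) : WithTop ℕ∞) (residue μ K t) →
      ‖gradAtZero (residue μ K t) - (fun i => Complex.I * m i)‖ ≤ r →
      (∀ k ≤ d + 1, ∀ (α : Fin k → Fin d) (ζ : EuclideanSpace ℝ (Fin d)), (∀ i, |ζ i| ≤ B) →
        ‖partialDeriv α (residue μ K t) ζ‖ ≤ M) →
      Real.sqrt t * convexDist (μ.map fun x => (Real.sqrt t)⁻¹ • x)
          (modifiedGaussian K (fun i => Complex.I * m i) t)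
        ≤ C₀ * c * (d * r + d ^ (d + 1) * M * (c / Real.sqrt t) + (1 + D) / B) := by
  obtain ⟨C₀, hC₀, H⟩ := exists_abs_sub_modifiedGaussian_le hd
  refine ⟨C₀, hC₀, ?_⟩
  intro μ K t R c r M B D m hμ hK ht hR hKR hc hct hB hr hM hmD hcd hgrad hpart
  have hst : 0 < Real.sqrt t := Real.sqrt_pos.2 ht
  have hc0 : 0 ≤ c := by rw [hc]; positivity
  have hs1 : c / Real.sqrt t ≤ 1 := (div_le_one hst).2 hct
  have hs0 : 0 ≤ c / Real.sqrt t := by positivity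
  have hd1 : (1 : ℝ) ≤ d := by exact_mod_cast hd
  have hD : 0 ≤ D := (norm_nonneg m).trans hmD
  have key := H μ K t R (c / Real.sqrt t) (d * r) (d ^ (d + 1) * M) B m hμ hK ht hR hKR
    (by rw [hc]) hs1 (hs1.trans hB) (by positivity) (by positivity)
    (contDiff_residueRemainder m hcd) ?_ ?_
  · rw [← le_div_iff₀' hst]
    refine convexDist_le fun C hC hCc => (key C hC hCc).trans ?_
    rw [mul_assoc C₀ c, mul_div_assoc C₀]
    refine mul_le_mul_of_nonneg_left ?_ hC₀
    rw [le_div_iff₀ hst]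
    have e : ∀ x : ℝ, (d * r * (c / Real.sqrt t) + d ^ (d + 1) * M * (c / Real.sqrt t) ^ 2
        + (1 + x) * (c / Real.sqrt t / B)) * Real.sqrt t
        = c * (d * r + d ^ (d + 1) * M * (c / Real.sqrt t) + (1 + x) / B) := fun x => by
      field_simp
    rw [e]
    have : c / Real.sqrt t * ‖m‖ ≤ D :=
      (mul_le_of_le_one_left (norm_nonneg m) hs1).trans hmD
    gcongr
  · rw [← norm_iteratedFDeriv_one, ← pow_one (d : ℝ)]
    refine norm_le_of_norm_apply_single_le _ hr fun α => ?_
    change ‖partialDeriv α _ 0‖ ≤ r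
    rw [partialDeriv_one, gradAtZero_residueRemainder m (hcd.differentiable (by simp) 0)]
    exact (norm_le_pi_norm _ (α 0)).trans hgrad
  · intro k hk2 hk u hu
    rw [iteratedFDeriv_residueRemainder m (hcd.of_le (by exact_mod_cast hk)) hk2]
    refine (norm_le_of_norm_apply_single_le _ hM fun α => hpart k hk α u fun i =>
      (PiLp.norm_apply_le u i).trans hu).trans ?_
    gcongr

theorem tendsto_sqrt_mul_convexDist_uniform (d : ℕ) {R : ℝ} (hR : 0 < R) {T r : ℕ → ℝ}
    (M : ℝ → ℝ) (hT : Tendsto T atTop atTop) (hr : Tendsto r atTop (𝓝 0)) {η : ℝ} (hη : 0 < η) :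
    ∃ N : ℕ, ∀ (μ : ℕ → Measure (EuclideanSpace ℝ (Fin d))) (K : Matrix (Fin d) (Fin d) ℝ)
      (t : ℕ → ℝ) (θ : EuclideanSpace ℝ (Fin d) → ℂ), (∀ n, IsProbabilityMeasure (μ n)) →
      StrongFourierModGaussian μ K t θ → (∀ x, quadForm K⁻¹ x ≤ R * ‖x‖ ^ 2) →
      (∀ n, T n ≤ t n) →
      (∀ n, ‖gradAtZero (residue (μ n) K (t n)) - gradAtZero θ‖ ≤ r n) →
      (∀ B > 0, ∀ n, ∀ k ≤ d + 1, ∀ (α : Fin k → Fin d) (ζ : EuclideanSpace ℝ (Fin d)),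
        (∀ i, |ζ i| ≤ B) → ‖partialDeriv α (residue (μ n) K (t n)) ζ‖ ≤ M B) →
      ∀ n ≥ N, Real.sqrt (t n) * convexDist ((μ n).map fun x => (Real.sqrt (t n))⁻¹ • x)
        (modifiedGaussian K (gradAtZero θ) (t n)) ≤ η := by
  rcases Nat.eq_zero_or_pos d with hd | hd
  · refine ⟨0, fun μ K t θ hμ h _ _ _ _ n _ => ?_⟩
    have := hμ n
    have : IsProbabilityMeasure ((μ n).map fun x => (Real.sqrt (t n))⁻¹ • x) :=
      Measure.isProbabilityMeasure_map (by fun_prop)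
    rw [h.gradAtZero_eq, convexDist_modifiedGaussian_of_dim_zero hd _ h.posDef, mul_zero]
    exact hη.le
  · obtain ⟨C₀, hC₀, H⟩ := exists_sqrt_mul_convexDist_le hd
    set c := 2 * Real.pi * Real.sqrt R with hc
    have hc0 : 0 ≤ c := by positivity
    -- First partial derivatives of the residues at 0 are at most M 1, hence so are those of the
    -- limit: D bounds ‖m‖ independently of the data.
    set D : ℝ := d * |M 1| with hD
    -- B is fixed before n: the expression is the limit of the bound below as n grows, and only its
    -- last term survives. Its form matches that limit term by term.
    obtain ⟨B, hB, hBη⟩ : ∃ B : ℝ, 1 ≤ B ∧ C₀ * c * (d * |(0 : ℝ)| + 0 + (1 + D) / B) < η := by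
      have h1 : Tendsto (fun B : ℝ => C₀ * c * (d * |(0 : ℝ)| + 0 + (1 + D) / B)) atTop (𝓝 0) := by
        have := (tendsto_const_nhds (x := 1 + D) |>.div_atTop
          (tendsto_id (α := ℝ) (x := atTop))).const_mul (C₀ * c)
        simpa using this
      obtain ⟨B, hB⟩ := ((eventually_ge_atTop 1).and (h1.eventually_lt_const hη)).exists
      exact ⟨B, hB⟩
    have hsT : Tendsto (fun n => Real.sqrt (T n)) atTop atTop :=
      Real.tendsto_sqrt_atTop.comp hT
    have h2 : Tendsto (fun n => C₀ * c * (d * |r n| + d ^ (d + 1) * |M B| * (c / Real.sqrt (T n))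
        + (1 + D) / B)) atTop (𝓝 (C₀ * c * (d * |(0 : ℝ)| + 0 + (1 + D) / B))) := by
      refine ((((hr.abs.const_mul _).add ?_)).add_const _).const_mul _
      simpa using (tendsto_const_nhds.div_atTop hsT).const_mul (d ^ (d + 1) * |M B|)
    -- Only T, r, M, R, d and η enter here; t n ≥ T n then gives the bound for all admissible data.
    obtain ⟨N, hN⟩ := eventually_atTop.1 ((h2.eventually_lt_const hBη).and
      ((hT.eventually_gt_atTop 0).and (hsT.eventually_ge_atTop c)))
    refine ⟨N, fun μ K t θ hμ h hKR hTt hgr hpart n hn => ?_⟩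
    obtain ⟨hn1, hn2, hn3⟩ := hN n hn
    have hsTt : Real.sqrt (T n) ≤ Real.sqrt (t n) := Real.sqrt_le_sqrt (hTt n)
    have hsT0 : 0 < Real.sqrt (T n) := Real.sqrt_pos.2 hn2
    have hm : ‖imGradAtZero θ‖ ≤ D := by
      refine norm_le_card_mul fun i => ?_
      have h3 : ‖gradAtZero θ i‖ ≤ |M 1| := by
        refine le_of_tendsto (tendsto_pi_nhds.1 h.tendsto_gradAtZero i).norm
          (Eventually.of_forall fun k => ?_)
        have := hpart 1 one_pos k 1 (by omega) (fun _ => i) 0 (by simp)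
        rw [partialDeriv_one] at this
        exact this.trans (le_abs_self _)
      exact (Complex.abs_im_le_norm _).trans h3
    have hgn := hgr n
    rw [h.gradAtZero_eq] at hgn ⊢
    refine (H (μ n) K (t n) R c |r n| |M B| B D (imGradAtZero θ) (hμ n) h.posDef
      (hn2.trans_le (hTt n)) hR hKR hc (hn3.trans hsTt) hB (abs_nonneg _) (abs_nonneg _) hm
      (h.contDiff_residue n) (hgn.trans (le_abs_self _)) fun k hk α ζ hζ =>
      (hpart B (one_pos.trans_le hB) n k hk α ζ hζ).trans (le_abs_self _)).trans
      (le_trans ?_ hn1.le)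
    gcongr

end Distance

/-! ### Local bounds extracted from the convergence. -/

section LocalBounds

/-- Uniform convergence on the compact set handles all large n, continuity each of the finitely many
others. -/
theorem exists_forall_norm_le_of_tendstoLocallyUniformly {X F : Type*} [TopologicalSpace X]
    [NormedAddCommGroup F] {f : ℕ → X → F} {g : X → F} (h : TendstoLocallyUniformly f g atTop)
    (hf : ∀ n, Continuous (f n)) (hg : Continuous g) {Q : Set X} (hQ : IsCompact Q) :
    ∃ b, ∀ n, ∀ x ∈ Q, ‖f n x‖ ≤ b := by
  have hu := (tendstoLocallyUniformlyOn_iff_tendstoUniformlyOn_of_compact hQ).1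
    (h.tendstoLocallyUniformlyOn (s := Q))
  obtain ⟨N, hN⟩ := eventually_atTop.1 (Metric.tendstoUniformlyOn_iff.1 hu 1 one_pos)
  obtain ⟨b₀, hb₀⟩ := hQ.exists_bound_of_continuousOn hg.continuousOn
  choose b hb using fun n => hQ.exists_bound_of_continuousOn (hf n).continuousOn
  refine ⟨|b₀| + 1 + ∑ n ∈ Finset.range N, |b n|, fun n x hx => ?_⟩
  have hs : 0 ≤ ∑ n ∈ Finset.range N, |b n| := Finset.sum_nonneg fun _ _ => abs_nonneg _
  rcases lt_or_ge n N with hn | hn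
  · have := Finset.single_le_sum (f := fun n => |b n|) (fun _ _ => abs_nonneg _)
      (Finset.mem_range.2 hn)
    linarith [hb n x hx, le_abs_self (b n), abs_nonneg b₀]
  · have h1 := hN n hn x hx
    rw [dist_eq_norm] at h1
    have h2 := norm_le_norm_add_norm_sub' (f n x) (g x)
    rw [norm_sub_rev] at h2
    linarith [hb₀ x hx, le_abs_self b₀]

variable {d : ℕ}

theorem StrongFourierModGaussian.exists_partialDeriv_bound
    {μ : ℕ → Measure (EuclideanSpace ℝ (Fin d))} {K : Matrix (Fin d) (Fin d) ℝ} {t : ℕ → ℝ}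
    {θ : EuclideanSpace ℝ (Fin d) → ℂ} (h : StrongFourierModGaussian μ K t θ) (B : ℝ) :
    ∃ M : ℝ, ∀ n, ∀ k ≤ d + 1, ∀ (α : Fin k → Fin d) (ζ : EuclideanSpace ℝ (Fin d)),
      (∀ i, |ζ i| ≤ B) → ‖partialDeriv α (residue (μ n) K (t n)) ζ‖ ≤ M := by
  have hcont : ∀ (f : EuclideanSpace ℝ (Fin d) → ℂ), ContDiff ℝ ((d + 1 : ℕ) : WithTop ℕ∞) f →
      ∀ k ≤ d + 1, ∀ α : Fin k → Fin d, Continuous (partialDeriv α f) := by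
    intro f hf k hk α
    have h1 : Continuous (iteratedFDeriv ℝ k f) :=
      hf.continuous_iteratedFDeriv (by exact_mod_cast hk)
    exact (ContinuousMultilinearMap.apply ℝ _ ℂ _).continuous.comp h1
  -- The cube of half-side B lies in the ball of radius d B.
  have hex : ∀ k, k ≤ d + 1 → ∀ α : Fin k → Fin d, ∃ b, ∀ n,
      ∀ ζ ∈ Metric.closedBall (0 : EuclideanSpace ℝ (Fin d)) (d * B),
        ‖partialDeriv α (residue (μ n) K (t n)) ζ‖ ≤ b := fun k hk α =>
    exists_forall_norm_le_of_tendstoLocallyUniformly (h.tendsto_partialDeriv k hk α)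
      (fun n => hcont _ (h.contDiff_residue n) k hk α) (hcont _ h.contDiff_limit k hk α)
      (isCompact_closedBall _ _)
  choose! b hb using hex
  refine ⟨∑ k ∈ Finset.range (d + 2), ∑ α : Fin k → Fin d, |b k α|, fun n k hk α ζ hζ => ?_⟩
  calc _ ≤ |b k α| := (hb k hk α n ζ (mem_closedBall_zero_iff.2 (norm_le_card_mul hζ))).trans
        (le_abs_self _)
    _ ≤ ∑ α : Fin k → Fin d, |b k α| :=
        Finset.single_le_sum (f := fun α => |b k α|) (fun _ _ => abs_nonneg _) (Finset.mem_univ α)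
    _ ≤ _ := Finset.single_le_sum (f := fun k => ∑ α : Fin k → Fin d, |b k α|)
        (fun _ _ => Finset.sum_nonneg fun _ _ => abs_nonneg _) (Finset.mem_range.2 (by omega))

theorem rescaledLaw_eq_map {Ω : Type*} [MeasurableSpace Ω] {P : Measure Ω}
    {X : Ω → EuclideanSpace ℝ (Fin d)} (hX : AEMeasurable X P) (t : ℝ) :
    rescaledLaw P X t = (P.map X).map fun x => (Real.sqrt t)⁻¹ • x := by
  rw [AEMeasurable.map_map_of_aemeasurable (by fun_prop) hX]
  rfl

theorem exists_quadForm_inv_le {K : Matrix (Fin d) (Fin d) ℝ} (hK : K.PosDef) :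
    ∃ R : ℝ, 0 < R ∧ ∀ x, quadForm K⁻¹ x ≤ R * ‖x‖ ^ 2 := by
  obtain ⟨T, -, hT, -⟩ := exists_whitening hK
  refine ⟨‖(T : EuclideanSpace ℝ (Fin d) →L[ℝ] EuclideanSpace ℝ (Fin d))‖ ^ 2 + 1, by positivity,
    fun x => ?_⟩
  have h1 : ‖T x‖ ≤ ‖(T : EuclideanSpace ℝ (Fin d) →L[ℝ] EuclideanSpace ℝ (Fin d))‖ * ‖x‖ :=
    (T : EuclideanSpace ℝ (Fin d) →L[ℝ] EuclideanSpace ℝ (Fin d)).le_opNorm x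
  calc quadForm K⁻¹ x = ‖T x‖ ^ 2 := by rw [quadForm, hT, real_inner_self_eq_norm_sq]
    _ ≤ (‖(T : EuclideanSpace ℝ (Fin d) →L[ℝ] EuclideanSpace ℝ (Fin d))‖ * ‖x‖) ^ 2 := by gcongr
    _ ≤ _ := by rw [mul_pow, add_mul]; linarith [sq_nonneg ‖x‖]

theorem isLittleO_convexDist {μ : ℕ → Measure (EuclideanSpace ℝ (Fin d))}
    [∀ n, IsProbabilityMeasure (μ n)] {K : Matrix (Fin d) (Fin d) ℝ}
    {t : ℕ → ℝ} {θ : EuclideanSpace ℝ (Fin d) → ℂ} (h : StrongFourierModGaussian μ K t θ) :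
    (fun n => convexDist ((μ n).map fun x => (Real.sqrt (t n))⁻¹ • x)
        (modifiedGaussian K (gradAtZero θ) (t n)))
      =o[atTop] (fun n => 1 / Real.sqrt (t n)) := by
  obtain ⟨R, hR, hKR⟩ := exists_quadForm_inv_le h.posDef
  choose M hM using h.exists_partialDeriv_bound
  have hr : Tendsto (fun n => ‖gradAtZero (residue (μ n) K (t n)) - gradAtZero θ‖) atTop (𝓝 0) :=
    tendsto_iff_norm_sub_tendsto_zero.1 h.tendsto_gradAtZero
  refine isLittleO_iff.2 fun η hη => ?_
  -- The uniform statement is applied with the data of the sequence itself: T = t, r the actual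
  -- gradient error, M the extracted bounds.
  obtain ⟨N, hN⟩ := tendsto_sqrt_mul_convexDist_uniform d hR M h.tendsto_param hr hη
  filter_upwards [eventually_ge_atTop N, h.tendsto_param.eventually_gt_atTop 0] with n hn ht
  have hst := Real.sqrt_pos.2 ht
  have := hN μ K t θ inferInstance h hKR (fun _ => le_rfl) (fun _ => le_rfl)
    (fun B _ => hM B) n hn
  rw [Real.norm_of_nonneg (convexDist_nonneg _ _), Real.norm_of_nonneg (by positivity),
    mul_one_div, le_div_iff₀' hst]
  exact this

end LocalBounds

/-! ### Conclusion. -/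

theorem mainTheorem2 (d : ℕ) :
    (∀ (Ω : ℕ → Type*) [∀ n, MeasurableSpace (Ω n)] (P : ∀ n, Measure (Ω n))
        [∀ n, IsProbabilityMeasure (P n)] (X : ∀ n, Ω n → EuclideanSpace ℝ (Fin d))
        (K : Matrix (Fin d) (Fin d) ℝ) (t : ℕ → ℝ) (θ : EuclideanSpace ℝ (Fin d) → ℂ),
      (∀ n, AEMeasurable (X n) (P n)) →
      StrongFourierModGaussian (fun n => (P n).map (X n)) K t θ →
      (∀ n ζ, signedFourier (modifiedGaussian K (gradAtZero θ) (t n)) ζ =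
        Complex.exp ((-(quadForm K ζ) / 2 : ℝ) : ℂ) *
          (1 + (∑ i, (ζ i : ℂ) * gradAtZero θ i) / (Real.sqrt (t n) : ℂ))) ∧
      (fun n => convexDist (rescaledLaw (P n) (X n) (t n))
          (modifiedGaussian K (gradAtZero θ) (t n)))
        =o[atTop] (fun n => 1 / Real.sqrt (t n))) ∧
    (∀ (R : ℝ) (T r : ℕ → ℝ) (M : ℝ → ℝ), Tendsto T atTop atTop → Tendsto r atTop (𝓝 0) →
      ∀ η > 0, ∃ N : ℕ,
      ∀ (Ω : ℕ → Type*) [∀ n, MeasurableSpace (Ω n)] (P : ∀ n, Measure (Ω n))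
        [∀ n, IsProbabilityMeasure (P n)] (X : ∀ n, Ω n → EuclideanSpace ℝ (Fin d))
        (K : Matrix (Fin d) (Fin d) ℝ) (t : ℕ → ℝ) (θ : EuclideanSpace ℝ (Fin d) → ℂ),
      (∀ n, AEMeasurable (X n) (P n)) →
      StrongFourierModGaussian (fun n => (P n).map (X n)) K t θ →
      spectralRadius ℝ K⁻¹ ≤ ENNReal.ofReal R →
      (∀ n, T n ≤ t n) →
      (∀ n, ‖gradAtZero (residue ((P n).map (X n)) K (t n)) - gradAtZero θ‖ ≤ r n) →
      (∀ B > 0, ∀ n, ∀ k ≤ d + 1, ∀ (α : Fin k → Fin d) (ζ : EuclideanSpace ℝ (Fin d)),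
        (∀ i, |ζ i| ≤ B) → ‖partialDeriv α (residue ((P n).map (X n)) K (t n)) ζ‖ ≤ M B) →
      ∀ n ≥ N, Real.sqrt (t n) * convexDist (rescaledLaw (P n) (X n) (t n))
        (modifiedGaussian K (gradAtZero θ) (t n)) ≤ η) := by
  refine ⟨?_, ?_⟩
  · intro Ω _ P _ X K t θ hX h
    have hprob : ∀ n, IsProbabilityMeasure ((P n).map (X n)) := fun n =>
      Measure.isProbabilityMeasure_map (hX n)
    refine ⟨fun n ζ => ?_, ?_⟩
    · rw [h.gradAtZero_eq]
      exact signedFourier_modifiedGaussian h.posDef _ ζ (t n)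
    · simp only [rescaledLaw_eq_map (hX _)]
      exact isLittleO_convexDist h
  · intro R T r M hT hr η hη
    -- The given R may be zero or negative, whereas the estimates need a positive bound.
    have hR : 0 < max R 1 := one_pos.trans_le (le_max_right _ _)
    obtain ⟨N, hN⟩ := tendsto_sqrt_mul_convexDist_uniform d hR M hT hr hη
    refine ⟨N, ?_⟩
    intro Ω _ P _ X K t θ hX h hsp hTt hgr hpart n hn
    rw [rescaledLaw_eq_map (hX n)]
    exact hN _ K t θ (fun n => Measure.isProbabilityMeasure_map (hX n)) h
      (spectralRadius_quadForm_le h.posDef.inv hR.le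
        (hsp.trans (ENNReal.ofReal_le_ofReal (le_max_left _ _)))) hTt hgr hpart n hn
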